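/- Let $\gamma\in(0,1)$ and let $k\ge 1$ be an integer. Write $(a)_l=a(a+1)\cdots(a+l-1)$ for the rising factorial and $a^{(k)}_l$ for the Stirling numbers of the second kind. For positive random weights $w_1,\dots,w_n$ put $p_i=w_i/\sum_{j=1}^n w_j$, and let $S_n$ be the stationary search cost of the Move-to-Front rule with request probabilities $p_1,\dots,p_n$: given $p$, the list is distributed according to the stationary law $P(\sigma)=\prod_{j=1}^n p_{\sigma_j}/(1-p_{\sigma_1}-\cdots-p_{\sigma_{j-1}})$ of the Move-to-Front Markov chain, an item $R$ is drawn independently of the list with $P(R=i)=p_i$, and $S_n$ is the number of items that precede $R$ in the list. For the Laplace exponent $\psi$ of a subordinator let $$\Psi_\psi(l)=-\int_0^\infty\!\!\int_0^\infty[\psi(x+y)-\psi(x)]^l\,\psi''(x+y)\,e^{-\psi(x)}\,dx\,dy\in[0,\infty].$$ (1) Let $u\ge0$, let $\xi=(\xi_t)_{t\in[0,1]}$ be a generalized gamma subordinator with parameters $(\gamma,u)$, i.e. a subordinator with Lévy measure $\Gamma(1-\gamma)^{-1}y^{-(1+\gamma)}e^{-uy}\,dy$ on $(0,\infty)$, let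 $\psi$ be its Laplace exponent and $\Psi=\Psi_\psi$, and let $w_i=\xi_{i/n}-\xi_{(i-1)/n}$, $i=1,\dots,n$. If $\gamma<\frac1{k+1}$, then $$\Psi(l)=\frac{(l!)^2}{(\frac1\gamma-l-1)_l}\sum_{m=0}^l\frac{u^{m\gamma}}{m!\,\gamma^m}\quad(1\le l\le k)\qquad\text{and}\qquad\lim_{n\to\infty}\mathbb E[S_n^k]=\sum_{l=1}^k a_l^{(k)}\,\Psi(l).$$ If $\gamma\ge\frac1{k+1}$, then $\Psi(k)=\infty$ and $\lim_{n\to\infty}\mathbb E[S_n^k]=\infty$. (2) Let $\theta>0$, let $\xi=(\xi_t)_{t\ge0}$ be a subordinator with Lévy measure $\frac{\gamma}{\Gamma(1-\gamma)}y^{-(1+\gamma)}e^{-y}\,dy$ on $(0,\infty)$, so that its Laplace exponent is $\psi(s)=(1+s)^\gamma-1$, let $Z$ be a Gamma$(\theta/\gamma,1)$ random variable independent of $\xi$, and let $w_i=\xi_{Zi/n}-\xi_{Z(i-1)/n}$, $i=1,\dots,n$ (the two-parameter Poisson–Dirichlet weights with parameters $(\gamma,\theta)$). Put $\Psi(l)=\mathbb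 E[\Psi_{Z\psi}(l)]$, where $\Psi_{z\psi}$ belongs to the Laplace exponent $z\psi$ of $t\mapsto\xi_{zt}$. If $\gamma<\frac1{k+1}$, then $$\Psi(l)=l!\,\frac{(\theta/\gamma+1)_l}{(\frac1\gamma-l-1)_l}\quad(1\le l\le k)\qquad\text{and}\qquad\lim_{n\to\infty}\mathbb E[S_n^k]=\sum_{l=1}^k a_l^{(k)}\,\Psi(l).$$ If $\gamma\ge\frac1{k+1}$, then $\Psi(k)=\infty$ and $\lim_{n\to\infty}\mathbb E[S_n^k]=\infty$. -/

import Mathlib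

open MeasureTheory ProbabilityTheory Filter Topology
open scoped ENNReal NNReal

/-! ### The Move-to-Front chain and its stationary law

An arrangement of `n` items is a permutation `σ : Equiv.Perm (Fin n)`, where `σ j` is the item in
position `j` (position `0` is the top of the heap). -/

/-- The arrangement obtained from `σ` by moving item `i` to the front and leaving the relative
order of the other items unchanged: if `i` is in position `k`, the items in positions `0,…,k-1` are
shifted to positions `1,…,k`. -/
def moveToFront {n : ℕ} (i : Fin n) (σ : Equiv.Perm (Fin n)) : Equiv.Perm (Fin n) :=
  σ * (Fin.cycleRange (σ.symm i))⁻¹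

/-- One-step transition probabilities of the Move-to-Front chain with request probabilities `p`. -/
noncomputable def mtfTransition {n : ℕ} (p : Fin n → ℝ) (σ τ : Equiv.Perm (Fin n)) : ℝ :=
  ∑ i, if moveToFront i σ = τ then p i else 0

/-- `π` is a stationary distribution of the Move-to-Front chain with request probabilities `p`. -/
structure IsMtfStationary {n : ℕ} (p : Fin n → ℝ) (π : Equiv.Perm (Fin n) → ℝ) : Prop where
  nonneg : ∀ σ, 0 ≤ π σ
  sum_eq_one : ∑ σ, π σ = 1
  invariant : ∀ τ, ∑ σ, π σ * mtfTransition p σ τ = π τ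

/-- The stationary distribution of the Move-to-Front chain,
`P(σ) = p_{σ_1} · p_{σ_2}/(1-p_{σ_1}) ⋯ p_{σ_n}/(1-(p_{σ_1}+⋯+p_{σ_{n-1}}))`. -/
noncomputable def mtfStationary {n : ℕ} (p : Fin n → ℝ) (σ : Equiv.Perm (Fin n)) : ℝ :=
  ∏ j, p (σ j) / (1 - ∑ i ∈ Finset.Iio j, p (σ i))

namespace MtfAux

/-- The product of the stationary law, for a list `f` of weights with total weight `c`. -/
noncomputable def W {n : ℕ} (c : ℝ) (f : Fin n → ℝ) : ℝ :=
  ∏ j, f j / (c - ∑ i ∈ Finset.Iio j, f i)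

theorem W_cons {n : ℕ} (c a : ℝ) (g : Fin n → ℝ) :
    W c (Fin.cons a g : Fin (n + 1) → ℝ) = a / c * W (c - a) g := by
  have h : ∀ j : Fin n, ∑ i ∈ Finset.Iio j.succ, (Fin.cons a g : Fin (n + 1) → ℝ) i
      = a + ∑ i ∈ Finset.Iio j, g i := by
    intro j
    have : Finset.Iio j.succ = insert 0 ((Finset.Iio j).map (Fin.succEmb n)) := by
      ext i
      refine Fin.cases ?_ (fun i => ?_) i <;> simp
    rw [this, Finset.sum_insert (by simp), Finset.sum_map]
    simp
  have h0 : Finset.Iio (0 : Fin (n + 1)) = ∅ := by ext i; simp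
  simp only [W]
  rw [Fin.prod_univ_succ]
  simp only [Fin.cons_zero, Fin.cons_succ, h, h0, Finset.sum_empty, sub_zero, sub_sub]

theorem sum_insert {n : ℕ} (x : ℝ) (hx : 0 < x) (g : Fin n → ℝ) (hg : ∀ i, 0 < g i) :
    ∑ k : Fin (n + 1), W (x + ∑ i, g i) (k.insertNth x g : Fin (n + 1) → ℝ) = W (∑ i, g i) g := by
  induction n with
  | zero =>
    have : (Fin.insertNth 0 x g : Fin 1 → ℝ) = Fin.cons x g := Fin.insertNth_zero' x g
    simp only [Fin.sum_univ_succ, Finset.univ_eq_empty, Finset.sum_empty, add_zero, this, W_cons]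
    simp [hx.ne', W]
  | succ n ih =>
    obtain ⟨a, h, rfl⟩ : ∃ a h, g = Fin.cons a h := ⟨g 0, Fin.tail g, (Fin.cons_self_tail g).symm⟩
    have ha : 0 < a := by simpa using hg 0
    have hh : ∀ i, 0 < h i := fun i => by simpa using hg i.succ
    have hH : 0 ≤ ∑ i, h i := Finset.sum_nonneg fun i _ => (hh i).le
    have ih' := ih h hh
    rw [Fin.sum_univ_succ (n := n + 1)]
    have e0 : (Fin.insertNth 0 x (Fin.cons a h) : Fin (n + 2) → ℝ) = Fin.cons x (Fin.cons a h) :=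
      Fin.insertNth_zero' _ _
    have e1 : ∀ i : Fin (n + 1), (Fin.insertNth i.succ x (Fin.cons a h) : Fin (n + 2) → ℝ)
        = Fin.cons a (Fin.insertNth i x h) := fun i => Fin.insertNth_succ_cons i x a h
    have e6 : ∑ i, (Fin.cons a h : Fin (n + 1) → ℝ) i = a + ∑ i, h i := by
      simp [Fin.sum_univ_succ]
    simp only [e0, e1, e6]
    simp only [W_cons]
    rw [← Finset.mul_sum]
    have e2 : x + (a + ∑ i, h i) - a = x + ∑ i, h i := by ring
    have e3 : x + (a + ∑ i, h i) - x - a = ∑ i, h i := by ring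
    have e4 : a + ∑ i, h i - a = ∑ i, h i := by ring
    have e5 : x + (a + ∑ i, h i) - x = a + ∑ i, h i := by ring
    rw [e2, e3, e4, ih', e5]
    have : a + ∑ i, h i ≠ 0 := by positivity
    have : x + (a + ∑ i, h i) ≠ 0 := by positivity
    field_simp

theorem insert_comp {n : ℕ} (f : Fin (n + 1) → ℝ) (k : Fin (n + 1)) :
    f ∘ k.cycleRange = k.insertNth (f 0) (Fin.tail f) := by
  rw [← Fin.cons_comp_cycleRange, Fin.cons_self_tail]

theorem sum_perm_W {n : ℕ} (f : Fin n → ℝ) (hf : ∀ i, 0 < f i) :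
    ∑ σ : Equiv.Perm (Fin n), W (∑ i, f i) (f ∘ σ) = 1 := by
  induction n with
  | zero => simp [W]
  | succ n ih =>
    let Φ : Fin (n + 1) × Equiv.Perm (Fin n) → Equiv.Perm (Fin (n + 1)) := fun q =>
      Equiv.Perm.decomposeFin.symm (0, q.2) * q.1.cycleRange
    have hΦ : Function.Bijective Φ := by
      rw [Fintype.bijective_iff_injective_and_card]
      refine ⟨?_, by simp [Fintype.card_perm, Nat.factorial_succ]⟩
      rintro ⟨k, e⟩ ⟨k', e'⟩ h
      have hk : ∀ (k : Fin (n + 1)) (e : Equiv.Perm (Fin n)), (Φ (k, e)).symm 0 = k := by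
        intro k e
        rw [Equiv.symm_apply_eq]
        simp [Φ]
      have : k = k' := by rw [← hk k e, ← hk k' e', h]
      subst this
      have := mul_right_cancel h
      simpa using this
    rw [← hΦ.sum_comp fun σ => W (∑ i, f i) (f ∘ σ), Fintype.sum_prod_type_right]
    rw [← ih (Fin.tail f) fun i => hf i.succ]
    refine Finset.sum_congr rfl fun e _ => ?_
    have key := sum_insert (f 0) (hf 0) (Fin.tail f ∘ e) fun i => hf (e i).succ
    have s1 : ∑ i, (Fin.tail f ∘ e) i = ∑ i, Fin.tail f i := Equiv.sum_comp e (Fin.tail f)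
    rw [s1] at key
    rw [← key]
    refine Finset.sum_congr rfl fun k _ => ?_
    rw [Fin.sum_univ_succ]
    congr 1
    have : f ∘ (Φ (k, e)) = (f ∘ Equiv.Perm.decomposeFin.symm (0, e)) ∘ k.cycleRange := rfl
    rw [this, insert_comp]
    congr 1

theorem mtfStationary_eq {n : ℕ} (p : Fin n → ℝ) (σ : Equiv.Perm (Fin n)) :
    mtfStationary p σ = W 1 (p ∘ σ) := rfl

theorem mtf_eq_iff {n : ℕ} (i : Fin (n + 1)) (σ τ : Equiv.Perm (Fin (n + 1))) :
    moveToFront i σ = τ ↔ i = τ 0 ∧ ∃ k : Fin (n + 1), σ = τ * k.cycleRange := by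
  constructor
  · rintro rfl
    refine ⟨?_, σ.symm i, by simp [moveToFront]⟩
    simp [moveToFront, Equiv.Perm.inv_def]
  · rintro ⟨rfl, k, rfl⟩
    have : (τ * k.cycleRange).symm (τ 0) = k := by
      rw [Equiv.symm_apply_eq]; simp
    simp [moveToFront, this]

theorem invariant {n : ℕ} (p : Fin n → ℝ) (hp : ∀ i, 0 < p i) (h1 : ∑ i, p i = 1)
    (τ : Equiv.Perm (Fin n)) :
    ∑ σ, mtfStationary p σ * mtfTransition p σ τ = mtfStationary p τ := by
  cases n with
  | zero => simp at h1
  | succ n =>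
    have hinj : Function.Injective fun k : Fin (n + 1) => τ * k.cycleRange := by
      intro k k' h
      have h' : k.cycleRange = k'.cycleRange := mul_left_cancel h
      rw [← Fin.cycleRange_symm_zero k, h', Fin.cycleRange_symm_zero]
    have hM : ∀ σ, mtfTransition p σ τ =
        if σ ∈ Finset.univ.image (fun k : Fin (n + 1) => τ * k.cycleRange) then p (τ 0) else 0 := by
      intro σ
      have h : σ ∈ Finset.univ.image (fun k : Fin (n + 1) => τ * k.cycleRange) ↔
          ∃ k : Fin (n + 1), σ = τ * k.cycleRange := by
        simp [eq_comm]
      simp only [mtfTransition, mtf_eq_iff, h]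
      by_cases h' : ∃ k : Fin (n + 1), σ = τ * k.cycleRange
      · simp [h']
      · simp [h']
    simp only [hM, mul_ite, mul_zero]
    rw [Finset.sum_ite_mem, Finset.univ_inter, Finset.sum_image fun _ _ _ _ h => hinj h,
      ← Finset.sum_mul]
    have hs : ∑ i, p i = p (τ 0) + ∑ i, Fin.tail (p ∘ τ) i := by
      rw [← Equiv.sum_comp τ p, Fin.sum_univ_succ]; rfl
    have key := sum_insert (p (τ 0)) (hp _) (Fin.tail (p ∘ τ)) fun i => hp _
    rw [← hs, h1] at key
    have e : ∀ k : Fin (n + 1), mtfStationary p (τ * k.cycleRange)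
        = W 1 (k.insertNth (p (τ 0)) (Fin.tail (p ∘ τ)) : Fin (n + 1) → ℝ) := fun k => by
      rw [mtfStationary_eq]
      exact congrArg _ (insert_comp (p ∘ τ) k)
    have e' : mtfStationary p τ = W 1 (Fin.cons (p (τ 0)) (Fin.tail (p ∘ τ)) : Fin (n + 1) → ℝ) := by
      rw [mtfStationary_eq]
      exact congrArg _ (Fin.cons_self_tail (p ∘ τ)).symm
    rw [Finset.sum_congr rfl fun k _ => e k, key, e', W_cons]
    have : ∑ i, Fin.tail (p ∘ τ) i = 1 - p (τ 0) := by linarith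
    rw [this]; ring

theorem mtfStationary_nonneg {n : ℕ} (p : Fin n → ℝ) (hp : ∀ i, 0 < p i) (h1 : ∑ i, p i = 1)
    (σ : Equiv.Perm (Fin n)) : 0 ≤ mtfStationary p σ := by
  refine Finset.prod_nonneg fun j _ => div_nonneg (hp _).le ?_
  have h2 : ∑ i ∈ Finset.Iio j, p (σ i) ≤ ∑ i, p (σ i) :=
    Finset.sum_le_sum_of_subset_of_nonneg (Finset.subset_univ _) fun _ _ _ => (hp _).le
  rw [Equiv.sum_comp σ p, h1] at h2
  linarith

theorem mem_of_cycleRange {n : ℕ} (N : Submonoid (Equiv.Perm (Fin n)))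
    (h : ∀ k : Fin n, (k.cycleRange)⁻¹ ∈ N) : N = ⊤ := by
  match n with
  | 0 => exact Subsingleton.elim _ _
  | 1 => exact Subsingleton.elim _ _
  | n + 2 =>
    have hc : ∀ k : Fin (n + 2), k.cycleRange ∈ N := fun k => by
      have := Subgroup.closure_toSubmonoid_of_finite (s := {(k.cycleRange)⁻¹})
      have h3 : k.cycleRange ∈ (Subgroup.closure {(k.cycleRange)⁻¹}).toSubmonoid := by
        simp
      rw [this] at h3
      exact (Submonoid.closure_le.2 (Set.singleton_subset_iff.2 (h k))) h3
    have hgen := Equiv.Perm.closure_cycle_adjacent_swap (isCycle_finRotate (n := n))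
      support_finRotate 0
    rw [eq_top_iff]
    intro c _
    have hcm : c ∈ (Subgroup.closure ({finRotate (n + 2),
        Equiv.swap 0 (finRotate (n + 2) 0)} : Set (Equiv.Perm (Fin (n + 2))))).toSubmonoid := by
      rw [hgen]; trivial
    rw [Subgroup.closure_toSubmonoid_of_finite] at hcm
    refine (Submonoid.closure_le.2 ?_) hcm
    rintro x (rfl | rfl)
    · rw [← Fin.cycleRange_last]; exact hc _
    · have hs : Equiv.swap 0 (finRotate (n + 2) 0) = Fin.cycleRange (1 : Fin (n + 2)) := by
        ext1 j
        rw [Fin.cycleRange_apply, Equiv.swap_apply_def, finRotate_apply, zero_add]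
        rcases eq_or_ne j 0 with rfl | h0
        · simp
        · have hj : ¬ j < 1 := by
            rwa [Fin.lt_one_iff]
          simp [h0, hj]
      rw [SetLike.mem_coe, hs]
      exact hc 1

theorem unique {n : ℕ} (p : Fin n → ℝ) (hp : ∀ i, 0 < p i) (h1 : ∑ i, p i = 1)
    (π π' : Equiv.Perm (Fin n) → ℝ) (h : IsMtfStationary p π) (h' : IsMtfStationary p π') :
    π = π' := by
  have hM0 : ∀ σ τ, 0 ≤ mtfTransition p σ τ := fun σ τ =>
    Finset.sum_nonneg fun i _ => by split_ifs <;> simp [(hp i).le]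
  have hM1 : ∀ σ, ∑ τ, mtfTransition p σ τ = 1 := fun σ => by
    simp only [mtfTransition]
    rw [Finset.sum_comm]
    simpa using h1
  -- a nonnegative invariant vector that is positive somewhere is positive everywhere
  have hpos : ∀ g : Equiv.Perm (Fin n) → ℝ, (∀ σ, 0 ≤ g σ) →
      (∀ τ, ∑ σ, g σ * mtfTransition p σ τ = g τ) → (∃ σ, 0 < g σ) → ∀ τ, 0 < g τ := by
    intro g g0 gi ⟨σ, hσ⟩ τ
    let N : Submonoid (Equiv.Perm (Fin n)) :=
      { carrier := {c | ∀ σ, 0 < g σ → 0 < g (σ * c)}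
        one_mem' := fun σ h => by simpa using h
        mul_mem' := fun {a b} ha hb σ h => by
          rw [← mul_assoc]; exact hb _ (ha _ h) }
    have hN : N = ⊤ := mem_of_cycleRange N fun k σ hσ => by
      rw [← gi]
      refine Finset.sum_pos' (fun ρ _ => mul_nonneg (g0 _) (hM0 _ _)) ⟨σ, Finset.mem_univ _, ?_⟩
      refine mul_pos hσ (Finset.sum_pos' (fun i _ => ?_) ⟨σ k, Finset.mem_univ _, ?_⟩)
      · split_ifs <;> simp [(hp i).le]
      · rw [if_pos (by simp [moveToFront])]; exact hp _
    have : σ⁻¹ * τ ∈ N := by rw [hN]; trivial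
    simpa using this σ hσ
  set d : Equiv.Perm (Fin n) → ℝ := fun σ => π σ - π' σ with hd
  have di : ∀ τ, ∑ σ, d σ * mtfTransition p σ τ = d τ := fun τ => by
    simp only [hd, sub_mul, Finset.sum_sub_distrib, h.invariant, h'.invariant]
  have ds : ∑ σ, d σ = 0 := by
    simp only [hd, Finset.sum_sub_distrib, h.sum_eq_one, h'.sum_eq_one, sub_self]
  have ai : ∀ τ, ∑ σ, |d σ| * mtfTransition p σ τ = |d τ| := by
    have hle : ∀ τ ∈ Finset.univ, |d τ| ≤ ∑ σ, |d σ| * mtfTransition p σ τ := fun τ _ => by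
      conv_lhs => rw [← di τ]
      refine (Finset.abs_sum_le_sum_abs _ _).trans_eq ?_
      exact Finset.sum_congr rfl fun σ _ => by rw [abs_mul, abs_of_nonneg (hM0 _ _)]
    have heq : ∑ τ, |d τ| = ∑ τ, ∑ σ, |d σ| * mtfTransition p σ τ := by
      rw [Finset.sum_comm]
      simp only [← Finset.mul_sum, hM1, mul_one]
    intro τ
    exact ((Finset.sum_eq_sum_iff_of_le hle).1 heq τ (Finset.mem_univ _)).symm
  by_contra hne
  obtain ⟨ρ, hρ⟩ : ∃ ρ, d ρ ≠ 0 := by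
    by_contra hall
    push Not at hall
    exact hne (funext fun σ => sub_eq_zero.1 (hall σ))
  have hP : ∀ s : ℝ, (s = 1 ∨ s = -1) → (∃ σ, 0 < s * d σ) → ∀ τ, 0 < s * d τ := by
    intro s hs ⟨σ, hσ⟩ τ
    have hnn : ∀ τ, 0 ≤ |d τ| + s * d τ := fun τ => by
      rcases hs with rfl | rfl
      · have := neg_abs_le (d τ); linarith
      · have := le_abs_self (d τ); linarith
    have := hpos (fun τ => |d τ| + s * d τ) hnn (fun τ => by
      simp only [add_mul, Finset.sum_add_distrib, mul_assoc, ← Finset.mul_sum, ai, di])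
      ⟨σ, add_pos_of_nonneg_of_pos (abs_nonneg _) hσ⟩ τ
    by_contra hneg
    have hab : |s * d τ| = |d τ| := by rcases hs with rfl | rfl <;> simp
    rw [← hab, abs_of_nonpos (not_lt.1 hneg)] at this
    simp at this
  rcases lt_or_gt_of_ne hρ with hlt | hgt
  · have := Finset.sum_pos (fun τ _ => hP (-1) (Or.inr rfl) ⟨ρ, by linarith⟩ τ)
      (Finset.univ_nonempty (α := Equiv.Perm (Fin n)))
    rw [← Finset.mul_sum, ds] at this
    simp at this
  · have := Finset.sum_pos (fun τ _ => hP 1 (Or.inl rfl) ⟨ρ, by linarith⟩ τ)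
      (Finset.univ_nonempty (α := Equiv.Perm (Fin n)))
    rw [← Finset.mul_sum, ds] at this
    simp at this

end MtfAux

/-- For positive request probabilities, `mtfStationary p` is the one and only stationary
distribution of the Move-to-Front chain. -/
theorem isMtfStationary_iff {n : ℕ} (p : Fin n → ℝ) (hp : ∀ i, 0 < p i) (h1 : ∑ i, p i = 1)
    (π : Equiv.Perm (Fin n) → ℝ) : IsMtfStationary p π ↔ π = mtfStationary p := by
  have hs : IsMtfStationary p (mtfStationary p) :=
    ⟨MtfAux.mtfStationary_nonneg p hp h1, by
      have := MtfAux.sum_perm_W p hp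
      rwa [h1] at this, MtfAux.invariant p hp h1⟩
  exact ⟨fun h => MtfAux.unique p hp h1 _ _ h hs, fun h => h ▸ hs⟩

/-! ### The stationary search cost -/

/-- The search cost of item `i` in the arrangement `σ`: the number of items preceding it. -/
def searchCost {n : ℕ} (σ : Equiv.Perm (Fin n)) (i : Fin n) : ℕ :=
  (Finset.univ.filter fun j => j ≠ i ∧ σ.symm j < σ.symm i).card

/-- The `k`-th moment of the stationary search cost, given the request probabilities `p`: the
arrangement `σ` is at equilibrium and the requested item `r` is drawn from `p` independently. -/
noncomputable def searchCostMoment {n : ℕ} (k : ℕ) (p : Fin n → ℝ) : ℝ :=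
  ∑ σ : Equiv.Perm (Fin n), ∑ r, mtfStationary p σ * p r * (searchCost σ r : ℝ) ^ k

/-- Normalization `p_i = w_i / ∑_j w_j` of a vector of weights. -/
noncomputable def normalizedWeights {n : ℕ} (w : Fin n → ℝ) (i : Fin n) : ℝ :=
  w i / ∑ j, w j

/-- The `k`-th moment `E[S_n ^ k]` of the stationary search cost `S_n` when the request
probabilities are the normalization of the random weights `w`. -/
noncomputable def meanSearchCostMoment {Ω : Type*} [MeasurableSpace Ω] (P : Measure Ω) {n : ℕ}
    (w : Ω → Fin n → ℝ) (k : ℕ) : ℝ≥0∞ :=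
  ∫⁻ ω, ENNReal.ofReal (searchCostMoment k (normalizedWeights (w ω))) ∂P

/-! ### Subordinators -/

/-- `ξ` is a subordinator with time set `I` (`I = [0,1]` or `I = [0,∞)`): independent and
stationary increments, started at `0`, with right-continuous non-decreasing paths. -/
structure IsSubordinatorOn {Ω : Type*} [MeasurableSpace Ω] (I : Set ℝ) (ξ : ℝ → Ω → ℝ)
    (P : Measure Ω) : Prop where
  measurable : ∀ t ∈ I, Measurable (ξ t)
  indep : HasIndepIncrements (fun t : I => ξ t) P
  zero : ∀ᵐ ω ∂P, ξ 0 ω = 0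
  stationary : ∀ s ∈ I, ∀ t ∈ I, s ≤ t →
    IdentDistrib (fun ω => ξ t ω - ξ s ω) (ξ (t - s)) P P
  paths : ∀ᵐ ω ∂P, MonotoneOn (fun t => ξ t ω) I ∧
    ∀ t ∈ I, ContinuousWithinAt (fun r => ξ r ω) (I ∩ Set.Ici t) t

/-- The Laplace exponent `ψ(s) = ∫ (1 - e^{-sy}) ν(dy)` of a Lévy measure `ν`. -/
noncomputable def laplaceExponent (ν : Measure ℝ) (s : ℝ) : ℝ :=
  ∫ y, (1 - Real.exp (-(s * y))) ∂ν

/-- `ν` is the Lévy measure of `ξ`: it lives on `(0,∞)`, integrates `min 1 y`, and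
`E[e^{-s ξ_t}] = e^{-t ψ(s)}` where `ψ` is its Laplace exponent. -/
structure HasLevyMeasureOn {Ω : Type*} [MeasurableSpace Ω] (I : Set ℝ) (ξ : ℝ → Ω → ℝ)
    (ν : Measure ℝ) (P : Measure Ω) : Prop where
  support : ν (Set.Iic 0) = 0
  integrable : Integrable (fun y => min 1 y) ν
  laplace : ∀ t ∈ I, ∀ s : ℝ, 0 ≤ s →
    ∫ ω, Real.exp (-(s * ξ t ω)) ∂P = Real.exp (-(t * laplaceExponent ν s))

/-- The Lévy measure `Γ(1-γ)⁻¹ y^{-(1+γ)} e^{-uy} dy` on `(0,∞)` of the generalized gamma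
subordinator with parameters `(γ, u)`. -/
noncomputable def genGammaLevy (γ u : ℝ) : Measure ℝ :=
  (volume.restrict (Set.Ioi 0)).withDensity fun y =>
    ENNReal.ofReal ((Real.Gamma (1 - γ))⁻¹ * y ^ (-(1 + γ)) * Real.exp (-(u * y)))

/-- The weights `w_i = ξ_{z t_i} - ξ_{z t_{i-1}}` with `t_i = i/n`, `i = 1,…,n`, at clock speed `z`
(the item with index `i : Fin n` carries the weight `w_{i+1}`). -/
noncomputable def incrementWeights {Ω : Type*} (ξ : ℝ → Ω → ℝ) (z : ℝ) (n : ℕ) (ω : Ω)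
    (i : Fin n) : ℝ :=
  ξ (z * (((i : ℝ) + 1) / n)) ω - ξ (z * ((i : ℝ) / n)) ω

/-- The quantity
`Ψ(l) = -∫₀^∞ ∫₀^∞ [ψ(x+y) - ψ(x)]^l ψ''(x+y) e^{-ψ(x)} dx dy ∈ [0,∞]`
attached to a Laplace exponent `ψ`, whose integrand is non-negative as `ψ` is increasing and
concave. -/
noncomputable def limitPsi (ψ : ℝ → ℝ) (l : ℕ) : ℝ≥0∞ :=
  ∫⁻ y in Set.Ioi (0 : ℝ), ∫⁻ x in Set.Ioi (0 : ℝ),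
    ENNReal.ofReal (-((ψ (x + y) - ψ x) ^ l * deriv (deriv ψ) (x + y) * Real.exp (-ψ x)))

/-!
Under the stationary law the list orders the items as independent exponential clocks with rates
`w_i` ring, so a set `A` of items precedes `r` with probability
`∫ w_r e^{-w_r y} ∏_{j ∈ A} (1 - e^{-w_j y}) dy` (`sum_perm_W_precede`, by induction on the number
of items, removing the first one). Writing `1 / ∑ w = ∫ e^{-x ∑ w} dx`, the factorial moments of the
search cost become double integrals of products over the items. For independent weights the mean
factors (`meanSearchCostMoment_eq_of_iIndepFun`): with `φ` the Laplace transform of one of `n`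
identically distributed weights, the `l`-th factorial moment is
`n (n - 1) ⋯ (n - l) ∫∫ φ''(x + y) (φ(x) - φ(x + y))^l φ(x)^{n-1-l} dx dy`,
and Stirling numbers of the second kind turn factorial moments into moments.

For the increments of a generalized gamma subordinator, `φ = e^{-cη/n}` with
`η(s) = ((s + u)^γ - u^γ) / γ`, and the integrand tends pointwise to that of `Ψ(l)`. If
`γ < 1 / (l + 1)` it is dominated by an integrable function (`factorialMomentIntegrand_le`), and
otherwise Fatou's lemma gives the divergence, since `Ψ(l) = ∞`. The value of `Ψ(l)` comes from two
substitutions: the inner integral is a Beta integral, finite exactly when `γ < 1 / (l + 1)`, and the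
outer one is `∫ (s + t)^l e^{-s} ds`.

The Poisson–Dirichlet weights are increments at a random clock speed `Z`. Right-continuity of the
paths makes the evaluation of the process jointly measurable in path and time
(`measurable_rightLimitEval_mul`), so that by independence one can condition on `Z = z`
(`meanSearchCostMoment_randomClock`). Given `Z = z` the exponent is `zγη` with `u = 1`, and the
dominating function is a polynomial in `z`, integrable for the Gamma law.
-/

/-! ### The stationary law and independent exponential clocks -/

theorem pow_eq_sum_stirlingSecond_mul_descFactorial (s k : ℕ) :
    s ^ k = ∑ l ∈ Finset.range (k + 1), Nat.stirlingSecond k l * s.descFactorial l := by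
  induction k with
  | zero => simp
  | succ k ih =>
    have hs : ∀ l, s * s.descFactorial l = s.descFactorial (l + 1) + l * s.descFactorial l := by
      intro l
      rw [Nat.descFactorial_succ]
      rcases le_or_gt l s with h | h
      · rw [← add_mul, Nat.sub_add_cancel h]
      · simp [Nat.descFactorial_eq_zero_iff_lt.2 h]
    rw [pow_succ', ih, Finset.mul_sum]
    have e : ∀ l, s * (Nat.stirlingSecond k l * s.descFactorial l) =
        Nat.stirlingSecond k l * s.descFactorial (l + 1)
          + l * Nat.stirlingSecond k l * s.descFactorial l := fun l => by
      rw [mul_left_comm, hs]; ring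
    simp only [e, Finset.sum_add_distrib]
    rw [Finset.sum_range_succ' _ (k + 1)]
    simp only [Nat.stirlingSecond_succ_succ, Nat.stirlingSecond_succ_zero, zero_mul, add_zero,
      add_mul _ _ (Nat.descFactorial _ _), Finset.sum_add_distrib]
    rw [add_comm, Finset.sum_range_succ' (fun l => l * Nat.stirlingSecond k l * s.descFactorial l),
      Finset.sum_range_succ (fun l => (l + 1) * Nat.stirlingSecond k (l + 1) *
        s.descFactorial (l + 1)), Nat.stirlingSecond_eq_zero_of_lt (Nat.lt_succ_self k)]
    simp

/-- The survival integrand `e^{-c t} ∏_{j ∈ A} (1 - e^{-w_j t})` of independent exponential clocks: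
all clocks in `A` have rung before time `t`, and a further clock of rate `c` has not. -/
noncomputable def clockIntegrand {ι : Type*} (w : ι → ℝ) (A : Finset ι) (c t : ℝ) : ℝ :=
  Real.exp (-(c * t)) * ∏ j ∈ A, (1 - Real.exp (-(w j * t)))

theorem continuous_clockIntegrand {ι : Type*} (w : ι → ℝ) (A : Finset ι) (c : ℝ) :
    Continuous (clockIntegrand w A c) := by
  unfold clockIntegrand
  fun_prop

theorem clockIntegrand_nonneg {ι : Type*} {w : ι → ℝ} (hw : ∀ i, 0 < w i) (A : Finset ι) (c : ℝ)
    {t : ℝ} (ht : 0 ≤ t) : 0 ≤ clockIntegrand w A c t := by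
  refine mul_nonneg (Real.exp_pos _).le (Finset.prod_nonneg fun j _ => ?_)
  have := mul_nonneg (hw j).le ht
  simpa using this

theorem clockIntegrand_le {ι : Type*} {w : ι → ℝ} (hw : ∀ i, 0 < w i) (A : Finset ι) (c : ℝ)
    {t : ℝ} (ht : 0 ≤ t) : clockIntegrand w A c t ≤ Real.exp (-(c * t)) := by
  refine mul_le_of_le_one_right (Real.exp_pos _).le (Finset.prod_le_one (fun j _ => ?_) fun j _ => ?_)
  · have := mul_nonneg (hw j).le ht
    simpa using this
  · have := Real.exp_pos (-(w j * t))
    linarith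

theorem integrableOn_clockIntegrand {ι : Type*} {w : ι → ℝ} (hw : ∀ i, 0 < w i) (A : Finset ι)
    {c : ℝ} (hc : 0 < c) : IntegrableOn (clockIntegrand w A c) (Set.Ioi 0) := by
  have h : IntegrableOn (fun t => Real.exp (-(c * t))) (Set.Ioi 0) := by
    simpa using exp_neg_integrableOn_Ioi 0 hc
  refine Integrable.mono' h (continuous_clockIntegrand w A c).aestronglyMeasurable ?_
  filter_upwards [ae_restrict_mem measurableSet_Ioi] with t ht
  rw [Real.norm_of_nonneg (clockIntegrand_nonneg hw A c (le_of_lt ht))]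
  exact clockIntegrand_le hw A c (le_of_lt ht)

theorem integral_clockIntegrand_empty {ι : Type*} (w : ι → ℝ) {c : ℝ} (hc : 0 < c) :
    ∫ t in Set.Ioi (0 : ℝ), clockIntegrand w ∅ c t = c⁻¹ := by
  have := integral_exp_mul_Ioi (neg_lt_zero.2 hc) 0
  simpa [clockIntegrand, neg_div_neg_eq] using this

/-- First-step decomposition for the clocks, obtained by integrating the derivative of
`clockIntegrand w A c`, which vanishes at `0` and at `∞`. -/
theorem integral_clockIntegrand_recursion {ι : Type*} [DecidableEq ι] {w : ι → ℝ}
    (hw : ∀ i, 0 < w i) {A : Finset ι} (hA : A.Nonempty) {c : ℝ} (hc : 0 < c) :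
    (c + ∑ a ∈ A, w a) * ∫ t in Set.Ioi (0 : ℝ), clockIntegrand w A c t =
      ∑ a ∈ A, w a * ∫ t in Set.Ioi (0 : ℝ), clockIntegrand w (A.erase a) c t := by
  have hd : ∀ t ∈ Set.Ioi (0 : ℝ), HasDerivAt (clockIntegrand w A c)
      (∑ a ∈ A, w a * clockIntegrand w (A.erase a) c t
        - (c + ∑ a ∈ A, w a) * clockIntegrand w A c t) t := by
    intro t _
    have h1 : HasDerivAt (fun t => Real.exp (-(c * t))) (Real.exp (-(c * t)) * (-(c * 1))) t :=
      (((hasDerivAt_id t).const_mul c).neg).exp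
    have h2 : ∀ j ∈ A, HasDerivAt (fun t => 1 - Real.exp (-(w j * t)))
        (w j * Real.exp (-(w j * t))) t := fun j _ => by
      have := (((hasDerivAt_id' t).const_mul (w j)).fun_neg.exp).const_sub 1
      refine this.congr_deriv ?_
      ring
    have h3 := h1.mul (HasDerivAt.fun_finsetProd h2)
    refine h3.congr_deriv ?_
    have e : ∀ a ∈ A, (∏ j ∈ A.erase a, (1 - Real.exp (-(w j * t)))) * Real.exp (-(w a * t)) =
        (∏ j ∈ A.erase a, (1 - Real.exp (-(w j * t)))) - ∏ j ∈ A, (1 - Real.exp (-(w j * t))) := by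
      intro a ha
      rw [← Finset.mul_prod_erase A _ ha]; ring
    have e2 : ∑ a ∈ A, (∏ j ∈ A.erase a, (1 - Real.exp (-(w j * t)))) •
        (w a * Real.exp (-(w a * t))) = ∑ a ∈ A, (w a * (∏ j ∈ A.erase a,
          (1 - Real.exp (-(w j * t))))) - (∑ a ∈ A, w a) * ∏ j ∈ A, (1 - Real.exp (-(w j * t))) := by
      rw [Finset.sum_mul, ← Finset.sum_sub_distrib]
      refine Finset.sum_congr rfl fun a ha => ?_
      rw [smul_eq_mul, mul_left_comm, e a ha]; ring
    rw [e2]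
    simp only [clockIntegrand]
    have e3 : ∑ a ∈ A, w a * (Real.exp (-(c * t)) * ∏ j ∈ A.erase a, (1 - Real.exp (-(w j * t)))) =
        Real.exp (-(c * t)) * ∑ a ∈ A, (w a * (∏ j ∈ A.erase a, (1 - Real.exp (-(w j * t))))) := by
      rw [Finset.mul_sum]
      exact Finset.sum_congr rfl fun a _ => by ring
    rw [e3]; ring
  have hI := fun a (_ : a ∈ A) =>
    (integrableOn_clockIntegrand hw (A.erase a) hc).const_mul (w a)
  have hI2 := (integrableOn_clockIntegrand hw A hc).const_mul (c + ∑ a ∈ A, w a)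
  have hlim : Tendsto (clockIntegrand w A c) atTop (𝓝 0) := by
    have h : Tendsto (fun t => Real.exp (-(c * t))) atTop (𝓝 0) :=
      Real.tendsto_exp_neg_atTop_nhds_zero.comp (tendsto_id.const_mul_atTop hc)
    refine tendsto_of_tendsto_of_tendsto_of_le_of_le' tendsto_const_nhds h ?_ ?_
    · filter_upwards [eventually_ge_atTop 0] with t ht using clockIntegrand_nonneg hw A c ht
    · filter_upwards [eventually_ge_atTop 0] with t ht using clockIntegrand_le hw A c ht
  have key := integral_Ioi_of_hasDerivAt_of_tendsto
    (continuous_clockIntegrand w A c).continuousWithinAt hd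
    ((integrable_finsetSum A hI).sub hI2) hlim
  rw [integral_sub (integrable_finsetSum A hI) hI2, integral_finsetSum A hI] at key
  simp only [integral_const_mul] at key
  have h0 : clockIntegrand w A c 0 = 0 := by
    obtain ⟨a, ha⟩ := hA
    simp only [clockIntegrand]
    rw [Finset.prod_eq_zero ha (by simp)]; simp
  rw [h0] at key
  linarith

/-- Under the stationary law of weights `w`, the items in `A` all precede `r` with the probability
that, of independent exponential clocks with rates `w`, all those in `A` ring before the one of
`r`. -/
theorem sum_perm_W_precede {n : ℕ} (w : Fin n → ℝ) (hw : ∀ i, 0 < w i) (A : Finset (Fin n))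
    (r : Fin n) (hr : r ∉ A) :
    ∑ σ : Equiv.Perm (Fin n),
        (if ∀ j ∈ A, σ.symm j < σ.symm r then MtfAux.W (∑ i, w i) (w ∘ σ) else 0) =
      w r * ∫ t in Set.Ioi (0 : ℝ), clockIntegrand w A (w r) t := by
  induction n with
  | zero => exact r.elim0
  | succ n ih =>
    set T := ∑ i, w i with hT
    have hT0 : 0 < T := Finset.sum_pos (fun i _ => hw i) Finset.univ_nonempty
    set J : Finset (Fin (n + 1)) → ℝ := fun A => ∫ t in Set.Ioi (0 : ℝ), clockIntegrand w A (w r) t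
      with hJ
    let e : Fin (n + 1) → Fin n → Fin (n + 1) := fun a i => Equiv.swap 0 a i.succ
    have he : ∀ a, Function.Injective (e a) := fun a i j h => by simpa [e] using h
    have hne : ∀ a i, e a i ≠ a := fun a i h => by
      have : Equiv.swap 0 a i.succ = Equiv.swap 0 a 0 := by simpa [e] using h
      exact Fin.succ_ne_zero _ ((Equiv.swap 0 a).injective this)
    have hex : ∀ a b, b ≠ a → ∃ i, e a i = b := fun a b h => by
      have h0 : Equiv.swap 0 a b ≠ 0 := fun h' => h (by
        rw [Equiv.swap_apply_eq_iff, Equiv.swap_apply_left] at h'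
        exact h')
      obtain ⟨i, hi⟩ := Fin.exists_succ_eq.2 h0
      exact ⟨i, by simp [e, hi]⟩
    have hsum : ∀ a, ∑ i, w (e a i) = T - w a := fun a => by
      have : T = ∑ i, w (Equiv.swap 0 a i) := (Equiv.sum_comp _ _).symm
      rw [this, Fin.sum_univ_succ, Equiv.swap_apply_left]
      simp [e]
    have hcons : ∀ a (τ : Equiv.Perm (Fin n)), w ∘ Equiv.Perm.decomposeFin.symm (a, τ) =
        Fin.cons (w a) ((w ∘ e a) ∘ τ) := fun a τ => by
      ext i
      refine Fin.cases ?_ (fun i => ?_) i <;> simp [e]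
    have hsym0 : ∀ a (τ : Equiv.Perm (Fin n)),
        (Equiv.Perm.decomposeFin.symm (a, τ)).symm a = 0 := fun a τ => by
      rw [Equiv.symm_apply_eq]; simp
    have hsym1 : ∀ a (τ : Equiv.Perm (Fin n)) i,
        (Equiv.Perm.decomposeFin.symm (a, τ)).symm (e a i) = (τ.symm i).succ := fun a τ i => by
      rw [Equiv.symm_apply_eq]; simp [e]
    rw [← Equiv.Perm.decomposeFin.symm.sum_comp, Fintype.sum_prod_type]
    simp only [hcons, MtfAux.W_cons]
    -- contribution of the arrangements with first item `a`
    have hstep : ∀ a, (∑ τ : Equiv.Perm (Fin n),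
        if ∀ j ∈ A, (Equiv.Perm.decomposeFin.symm (a, τ)).symm j <
          (Equiv.Perm.decomposeFin.symm (a, τ)).symm r then
          w a / T * MtfAux.W (T - w a) ((w ∘ e a) ∘ τ) else 0) =
        w a / T * (if a = r then (if A = ∅ then 1 else 0) else w r * J (A.erase a)) := by
      intro a
      rw [← hsum a]
      split_ifs with h1 h2
      · subst h2
        simp only [Finset.notMem_empty, false_imp_iff, implies_true, if_true, ← Finset.mul_sum]
        congr 1
        exact MtfAux.sum_perm_W (w ∘ e a) fun i => hw _
      · rw [mul_zero]
        refine Finset.sum_eq_zero fun τ _ => if_neg fun h => ?_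
        obtain ⟨j, hj⟩ := Finset.nonempty_iff_ne_empty.2 h2
        have := h j hj
        rw [← h1, hsym0] at this
        exact Fin.not_lt_zero _ this
      · obtain ⟨r', hr'⟩ := hex a r (Ne.symm h1)
        have hA : A.erase a = (A.preimage (e a) (he a).injOn).map ⟨e a, he a⟩ := by
          ext b
          simp only [Finset.mem_erase, Finset.mem_map, Finset.mem_preimage,
            Function.Embedding.coeFn_mk]
          constructor
          · rintro ⟨hb, hbA⟩
            obtain ⟨i, rfl⟩ := hex a b hb
            exact ⟨i, hbA, rfl⟩
          · rintro ⟨i, hi, rfl⟩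
            exact ⟨hne a i, hi⟩
        have hc : ∀ τ : Equiv.Perm (Fin n),
            (∀ j ∈ A, (Equiv.Perm.decomposeFin.symm (a, τ)).symm j <
              (Equiv.Perm.decomposeFin.symm (a, τ)).symm r) ↔
            ∀ j ∈ A.preimage (e a) (he a).injOn, τ.symm j < τ.symm r' := by
          intro τ
          rw [← hr', hsym1]
          constructor
          · intro h j hj
            have := h _ (Finset.mem_preimage.1 hj)
            rwa [hsym1, Fin.succ_lt_succ_iff] at this
          · intro h j hj
            by_cases hja : j = a
            · rw [hja, hsym0]; exact Fin.succ_pos _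
            · obtain ⟨i, rfl⟩ := hex a j hja
              rw [hsym1, Fin.succ_lt_succ_iff]
              exact h i (Finset.mem_preimage.2 hj)
        simp only [hc]
        have := ih (w ∘ e a) (fun i => hw _) (A.preimage (e a) (he a).injOn) r' (by simp [hr', hr])
        simp only [Function.comp_apply, hr'] at this
        have hJe : J (A.erase a) = ∫ t in Set.Ioi (0 : ℝ),
            clockIntegrand (w ∘ e a) (A.preimage (e a) (he a).injOn) (w r) t := by
          simp only [hJ, hA, clockIntegrand, Finset.prod_map, Function.Embedding.coeFn_mk,
            Function.comp_apply]
        rw [hJe, ← this, Finset.mul_sum]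
        refine Finset.sum_congr rfl fun τ _ => ?_
        split_ifs <;> simp
    simp only [hstep]
    change _ = w r * J A
    rcases A.eq_empty_or_nonempty with rfl | hA
    · have : J ∅ = (w r)⁻¹ := integral_clockIntegrand_empty w (hw r)
      simp only [Finset.erase_empty, this, mul_inv_cancel₀ (hw r).ne', if_true, ite_self, mul_one]
      rw [← Finset.sum_div, div_self hT0.ne']
    · have key : (w r + ∑ a ∈ A, w a) * J A = ∑ a ∈ A, w a * J (A.erase a) :=
        integral_clockIntegrand_recursion hw hA (hw r)
      have e1 : ∀ a, w a / T * (if a = r then (if A = ∅ then 1 else 0) else w r * J (A.erase a)) =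
          w r / T * (w a * J A + (if a ∈ A then w a * (J (A.erase a) - J A) else 0)
            - if a = r then w a * J A else 0) := by
        intro a
        by_cases h1 : a = r
        · simp [h1, hA.ne_empty, hr]
        · by_cases h2 : a ∈ A
          · simp only [h1, h2, if_true, if_false]; ring
          · simp only [h1, h2, if_false, Finset.erase_eq_of_notMem h2]; ring
      simp only [e1, ← Finset.mul_sum, Finset.sum_sub_distrib, Finset.sum_add_distrib]
      rw [Finset.sum_ite_mem, Finset.univ_inter, Finset.sum_ite_eq' Finset.univ r,
        if_pos (Finset.mem_univ _)]
      simp only [mul_sub, Finset.sum_sub_distrib, ← Finset.sum_mul, ← hT]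
      rw [← key]
      field_simp
      ring

theorem mtfStationary_normalizedWeights {n : ℕ} (w : Fin n → ℝ) (hw : ∀ i, 0 < w i)
    (σ : Equiv.Perm (Fin n)) :
    mtfStationary (normalizedWeights w) σ = MtfAux.W (∑ i, w i) (w ∘ σ) := by
  refine Finset.prod_congr rfl fun j _ => ?_
  have hT : 0 < ∑ i, w i := Finset.sum_pos (fun i _ => hw i) ⟨j, Finset.mem_univ _⟩
  simp only [normalizedWeights, Function.comp_apply, ← Finset.sum_div]
  rw [one_sub_div hT.ne', div_div_div_cancel_right₀ hT.ne']

/-- The moments of the search cost through its factorial moments: `l! * (S choose l)` counts the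
sets of `l` items preceding the requested one. -/
theorem searchCostMoment_normalizedWeights {n : ℕ} (k : ℕ) (w : Fin n → ℝ) (hw : ∀ i, 0 < w i) :
    searchCostMoment k (normalizedWeights w) =
      ∑ l ∈ Finset.range (k + 1), (Nat.stirlingSecond k l : ℝ) * ((l.factorial : ℝ) *
        ∑ r, ∑ A ∈ (Finset.univ.erase r).powersetCard l,
          w r / (∑ i, w i) * (w r * ∫ t in Set.Ioi (0 : ℝ), clockIntegrand w A (w r) t)) := by
  have h1 : ∀ (σ : Equiv.Perm (Fin n)) (r : Fin n), (searchCost σ r : ℝ) ^ k =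
      ∑ l ∈ Finset.range (k + 1), (Nat.stirlingSecond k l : ℝ) * ((l.factorial : ℝ) *
        ∑ A ∈ (Finset.univ.erase r).powersetCard l,
          if ∀ j ∈ A, σ.symm j < σ.symm r then (1 : ℝ) else 0) := by
    intro σ r
    have := pow_eq_sum_stirlingSecond_mul_descFactorial (searchCost σ r) k
    have hR := congrArg (Nat.cast : ℕ → ℝ) this
    push_cast at hR
    rw [hR]
    refine Finset.sum_congr rfl fun l _ => ?_
    congr 1
    rw [Nat.descFactorial_eq_factorial_mul_choose, searchCost, ← Finset.card_powersetCard,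
      Nat.cast_mul, ← Finset.sum_filter, Finset.sum_const, nsmul_eq_mul, mul_one]
    congr 3
    ext A
    simp only [Finset.mem_powersetCard, Finset.mem_filter, Finset.subset_iff, Finset.mem_univ,
      true_and, Finset.mem_erase, and_true]
    grind
  simp only [searchCostMoment, mtfStationary_normalizedWeights w hw, h1]
  simp only [Finset.mul_sum]
  rw [Finset.sum_congr rfl fun σ _ => Finset.sum_comm, Finset.sum_comm]
  refine Finset.sum_congr rfl fun l _ => ?_
  rw [Finset.sum_comm]
  refine Finset.sum_congr rfl fun r _ => ?_
  rw [Finset.sum_comm]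
  refine Finset.sum_congr rfl fun A hA => ?_
  have hr : r ∉ A := fun h => by
    simpa using (Finset.mem_powersetCard.1 hA).1 h
  rw [← sum_perm_W_precede w hw A r hr]
  simp only [Finset.mul_sum]
  refine Finset.sum_congr rfl fun σ _ => ?_
  simp only [normalizedWeights]
  split_ifs <;> ring

/-- The factor of item `i`, of weight `v`, in the integrand over `(x, y)` for the requested item `r`
and the set `A` of items before it. The integrand is the product of these factors, so that its mean
can be computed for independent weights. -/
noncomputable def itemFactor {n : ℕ} (A : Finset (Fin n)) (r : Fin n) (x y : ℝ) (i : Fin n)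
    (v : ℝ) : ℝ :=
  if i = r then v ^ 2 * Real.exp (-((x + y) * v))
  else if i ∈ A then Real.exp (-(x * v)) - Real.exp (-((x + y) * v))
  else Real.exp (-(x * v))

theorem itemFactor_nonneg {n : ℕ} (A : Finset (Fin n)) (r : Fin n) {x y : ℝ} (hy : 0 ≤ y)
    (i : Fin n) {v : ℝ} (hv : 0 ≤ v) : 0 ≤ itemFactor A r x y i v := by
  unfold itemFactor
  split_ifs
  · positivity
  · rw [sub_nonneg, Real.exp_le_exp]
    nlinarith
  · positivity

theorem prod_itemFactor {n : ℕ} (w : Fin n → ℝ) (A : Finset (Fin n)) (r : Fin n) (hr : r ∉ A)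
    (x y : ℝ) : ∏ i, itemFactor A r x y i (w i) =
      (w r ^ 2 * Real.exp (-(x * ∑ i, w i))) * clockIntegrand w A (w r) y := by
  have h : ∀ i, itemFactor A r x y i (w i) = Real.exp (-(x * w i)) *
      ((if i = r then w r ^ 2 * Real.exp (-(w r * y)) else 1) *
        if i ∈ A then 1 - Real.exp (-(w i * y)) else 1) := by
    intro i
    unfold itemFactor
    by_cases h1 : i = r
    · subst h1
      simp only [hr, if_true, if_false, mul_one]
      rw [mul_left_comm, ← Real.exp_add]; ring_nf
    · simp only [h1, if_false, one_mul]
      split_ifs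
      · rw [mul_sub, ← Real.exp_add]; ring_nf
      · ring
  simp only [h, Finset.prod_mul_distrib, ← Real.exp_sum, Finset.prod_ite_eq', Finset.mem_univ,
    if_true]
  rw [Finset.prod_ite_mem, Finset.univ_inter, clockIntegrand, Finset.mul_sum,
    Finset.sum_neg_distrib]
  ring

/-- The normalization `1 / ∑ w` is written as `∫ e^{-x ∑ w} dx`. -/
theorem ofReal_precede_eq_lintegral {n : ℕ} (w : Fin n → ℝ) (hw : ∀ i, 0 < w i)
    (A : Finset (Fin n)) (r : Fin n) (hr : r ∉ A) :
    ENNReal.ofReal (w r / (∑ i, w i) *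
        (w r * ∫ t in Set.Ioi (0 : ℝ), clockIntegrand w A (w r) t)) =
      ∫⁻ x in Set.Ioi (0 : ℝ), ∫⁻ y in Set.Ioi (0 : ℝ),
        ∏ i, ENNReal.ofReal (itemFactor A r x y i (w i)) := by
  have hT : 0 < ∑ i, w i := Finset.sum_pos (fun i _ => hw i) ⟨r, Finset.mem_univ _⟩
  have h1 : ∀ x, ∫⁻ y in Set.Ioi (0 : ℝ), ∏ i, ENNReal.ofReal (itemFactor A r x y i (w i)) =
      ENNReal.ofReal (w r ^ 2 * Real.exp (-(x * ∑ i, w i))) *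
        ENNReal.ofReal (∫ t in Set.Ioi (0 : ℝ), clockIntegrand w A (w r) t) := by
    intro x
    rw [ofReal_integral_eq_lintegral_ofReal (integrableOn_clockIntegrand hw A (hw r)),
      ← lintegral_const_mul' _ _ ENNReal.ofReal_ne_top]
    · refine setLIntegral_congr_fun measurableSet_Ioi fun y hy => ?_
      rw [← ENNReal.ofReal_prod_of_nonneg fun i _ => itemFactor_nonneg A r (le_of_lt hy) i (hw i).le,
        prod_itemFactor w A r hr, ENNReal.ofReal_mul (by positivity)]
    · filter_upwards [ae_restrict_mem measurableSet_Ioi] with t ht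
        using clockIntegrand_nonneg hw A _ (le_of_lt ht)
  have h2 : ∫⁻ x in Set.Ioi (0 : ℝ), ENNReal.ofReal (w r ^ 2 * Real.exp (-(x * ∑ i, w i))) =
      ENNReal.ofReal (w r ^ 2 / ∑ i, w i) := by
    rw [← ofReal_integral_eq_lintegral_ofReal, integral_const_mul]
    · have := integral_exp_mul_Ioi (neg_lt_zero.2 hT) 0
      simp only [mul_zero, Real.exp_zero, neg_div_neg_eq] at this
      simp only [neg_mul] at this
      simp only [mul_comm _ (∑ i, w i), this]
      rw [mul_one_div]
    · have := (exp_neg_integrableOn_Ioi 0 hT).const_mul (w r ^ 2)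
      simpa [mul_comm] using this
    · exact ae_of_all _ fun x => by positivity
  simp only [h1]
  rw [lintegral_mul_const' _ _ ENNReal.ofReal_ne_top, h2, ← ENNReal.ofReal_mul (by positivity)]
  congr 1
  ring

/-! ### Factorial moments for independent weights -/

theorem measurable_itemFactor {n : ℕ} (A : Finset (Fin n)) (r i : Fin n) :
    Measurable fun q : ℝ × ℝ × ℝ => itemFactor A r q.1 q.2.1 i q.2.2 := by
  unfold itemFactor
  split_ifs <;> fun_prop

theorem ofReal_searchCostMoment {n : ℕ} (k : ℕ) (w : Fin n → ℝ) (hw : ∀ i, 0 < w i) :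
    ENNReal.ofReal (searchCostMoment k (normalizedWeights w)) =
      ∑ l ∈ Finset.range (k + 1), (Nat.stirlingSecond k l : ℝ≥0∞) * ((l.factorial : ℝ≥0∞) *
        ∑ r, ∑ A ∈ (Finset.univ.erase r).powersetCard l,
          ∫⁻ x in Set.Ioi (0 : ℝ), ∫⁻ y in Set.Ioi (0 : ℝ),
            ∏ i, ENNReal.ofReal (itemFactor A r x y i (w i))) := by
  have hT : 0 ≤ ∑ i, w i := Finset.sum_nonneg fun i _ => (hw i).le
  have hnn : ∀ r A, 0 ≤ w r / (∑ i, w i) *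
      (w r * ∫ t in Set.Ioi (0 : ℝ), clockIntegrand w A (w r) t) := fun r A =>
    mul_nonneg (div_nonneg (hw r).le hT) (mul_nonneg (hw r).le
      (setIntegral_nonneg measurableSet_Ioi fun t ht =>
        clockIntegrand_nonneg hw A _ (le_of_lt ht)))
  have hnn2 : ∀ l r, 0 ≤ ∑ A ∈ (Finset.univ.erase r).powersetCard l, w r / (∑ i, w i) *
      (w r * ∫ t in Set.Ioi (0 : ℝ), clockIntegrand w A (w r) t) := fun l r =>
    Finset.sum_nonneg fun A _ => hnn r A
  rw [searchCostMoment_normalizedWeights k w hw, ENNReal.ofReal_sum_of_nonneg]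
  · refine Finset.sum_congr rfl fun l _ => ?_
    rw [ENNReal.ofReal_mul (by positivity), ENNReal.ofReal_mul (by positivity),
      ENNReal.ofReal_natCast, ENNReal.ofReal_natCast,
      ENNReal.ofReal_sum_of_nonneg fun r _ => hnn2 l r]
    congr 2
    refine Finset.sum_congr rfl fun r _ => ?_
    rw [ENNReal.ofReal_sum_of_nonneg fun A _ => hnn r A]
    refine Finset.sum_congr rfl fun A hA => ?_
    exact ofReal_precede_eq_lintegral w hw A r fun h => by
      simpa using (Finset.mem_powersetCard.1 hA).1 h
  · exact fun l _ => mul_nonneg (by positivity) (mul_nonneg (by positivity)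
      (Finset.sum_nonneg fun r _ => hnn2 l r))

/-- The moments of the search cost for independent identically distributed weights, through the
Laplace transform `L0 x = E[e^{-xw}]`, its increments `L1 x y = E[e^{-xw} - e^{-(x+y)w}]` and its
second derivative `L2 s = E[w² e^{-sw}]`. -/
theorem meanSearchCostMoment_eq_of_iIndepFun {Ω : Type*} [MeasurableSpace Ω] (P : Measure Ω)
    [IsProbabilityMeasure P] {n : ℕ} (w : Ω → Fin n → ℝ) (hm : ∀ i, Measurable fun ω => w ω i)
    (hI : iIndepFun (fun i ω => w ω i) P) (hpos : ∀ᵐ ω ∂P, ∀ i, 0 < w ω i)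
    (L0 L2 : ℝ → ℝ≥0∞) (L1 : ℝ → ℝ → ℝ≥0∞)
    (h0 : ∀ i x, 0 < x → ∫⁻ ω, ENNReal.ofReal (Real.exp (-(x * w ω i))) ∂P = L0 x)
    (h1 : ∀ i x y, 0 < x → 0 < y → ∫⁻ ω, ENNReal.ofReal
      (Real.exp (-(x * w ω i)) - Real.exp (-((x + y) * w ω i))) ∂P = L1 x y)
    (h2 : ∀ i s, 0 < s → ∫⁻ ω, ENNReal.ofReal (w ω i ^ 2 * Real.exp (-(s * w ω i))) ∂P = L2 s)
    (k : ℕ) (hk : 1 ≤ k) :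
    meanSearchCostMoment P w k = ∑ l ∈ Finset.Icc 1 k, (Nat.stirlingSecond k l : ℝ≥0∞) *
      ((n.descFactorial (l + 1) : ℝ≥0∞) * ∫⁻ x in Set.Ioi (0 : ℝ), ∫⁻ y in Set.Ioi (0 : ℝ),
        L2 (x + y) * L1 x y ^ l * L0 x ^ (n - 1 - l)) := by
  have hmeas : ∀ (A : Finset (Fin n)) (r : Fin n), Measurable fun q : Ω × ℝ × ℝ =>
      ∏ i, ENNReal.ofReal (itemFactor A r q.2.1 q.2.2 i (w q.1 i)) := by
    intro A r
    refine Finset.measurable_prod _ fun i _ => ENNReal.measurable_ofReal.comp ?_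
    exact (measurable_itemFactor A r i).comp (measurable_snd.fst.prodMk
      (measurable_snd.snd.prodMk ((hm i).comp measurable_fst)))
  have hmeas2 : ∀ (A : Finset (Fin n)) (r : Fin n), Measurable fun q : Ω × ℝ =>
      ∫⁻ y in Set.Ioi (0 : ℝ), ∏ i, ENNReal.ofReal (itemFactor A r q.2 y i (w q.1 i)) := by
    intro A r
    have := (hmeas A r).comp (MeasurableEquiv.prodAssoc (α := Ω) (β := ℝ) (γ := ℝ)).measurable
    exact Measurable.lintegral_prod_right' (f := fun q : (Ω × ℝ) × ℝ =>
      ∏ i, ENNReal.ofReal (itemFactor A r q.1.2 q.2 i (w q.1.1 i))) this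
  have hmeas3 : ∀ (A : Finset (Fin n)) (r : Fin n), Measurable fun ω : Ω =>
      ∫⁻ x in Set.Ioi (0 : ℝ), ∫⁻ y in Set.Ioi (0 : ℝ),
        ∏ i, ENNReal.ofReal (itemFactor A r x y i (w ω i)) := fun A r =>
    (hmeas2 A r).lintegral_prod_right'
  -- the mean of each summand
  have hmain : ∀ l, ∀ r, ∀ A ∈ (Finset.univ.erase r).powersetCard l,
      ∫⁻ ω, (∫⁻ x in Set.Ioi (0 : ℝ), ∫⁻ y in Set.Ioi (0 : ℝ),
        ∏ i, ENNReal.ofReal (itemFactor A r x y i (w ω i))) ∂P =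
      ∫⁻ x in Set.Ioi (0 : ℝ), ∫⁻ y in Set.Ioi (0 : ℝ),
        L2 (x + y) * L1 x y ^ l * L0 x ^ (n - 1 - l) := by
    intro l r A hA
    have hr : r ∉ A := fun h => by simpa using (Finset.mem_powersetCard.1 hA).1 h
    have hc : A.card = l := (Finset.mem_powersetCard.1 hA).2
    rw [lintegral_lintegral_swap (hmeas2 A r).aemeasurable]
    refine setLIntegral_congr_fun measurableSet_Ioi fun x hx => ?_
    have hx0 : (0 : ℝ) < x := hx
    rw [lintegral_lintegral_swap]
    · refine setLIntegral_congr_fun measurableSet_Ioi fun y hy => ?_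
      have hy0 : (0 : ℝ) < y := hy
      have hind := lintegral_prod_eq_prod_lintegral_of_indepFun Finset.univ
        (fun i ω => ENNReal.ofReal (itemFactor A r x y i (w ω i)))
        (hI.comp (fun i v => ENNReal.ofReal (itemFactor A r x y i v)) fun i =>
          ENNReal.measurable_ofReal.comp ((measurable_itemFactor A r i).comp
            (measurable_const.prodMk (measurable_const.prodMk measurable_id))))
        (fun i => ENNReal.measurable_ofReal.comp ((measurable_itemFactor A r i).comp
            (measurable_const.prodMk (measurable_const.prodMk (hm i)))))
      rw [hind]
      have hf : ∀ i, ∫⁻ ω, ENNReal.ofReal (itemFactor A r x y i (w ω i)) ∂P =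
          (if i = r then L2 (x + y) else 1) * ((if i ∈ A then L1 x y else 1) *
            if i ∈ (insert r A)ᶜ then L0 x else 1) := by
        intro i
        unfold itemFactor
        by_cases hi : i = r
        · subst hi
          simp [hr, h2 i (x + y) (by positivity)]
        · by_cases hiA : i ∈ A
          · simp [hi, hiA, h1 i x y hx0 hy0]
          · simp [hi, hiA, h0 i x hx0]
      simp only [hf, Finset.prod_mul_distrib, Finset.prod_ite_eq', Finset.mem_univ, if_true]
      rw [Finset.prod_ite_mem, Finset.prod_ite_mem, Finset.univ_inter, Finset.univ_inter,
        Finset.prod_const, Finset.prod_const, hc, Finset.card_compl, Finset.card_insert_of_notMem hr,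
        hc, Fintype.card_fin, mul_assoc, Nat.sub_sub, add_comm l 1]
    · exact ((hmeas A r).comp (measurable_fst.prodMk
        (measurable_const.prodMk measurable_snd))).aemeasurable
  have hae : ∫⁻ ω, ENNReal.ofReal (searchCostMoment k (normalizedWeights (w ω))) ∂P =
      ∫⁻ ω, (∑ l ∈ Finset.range (k + 1), (Nat.stirlingSecond k l : ℝ≥0∞) * ((l.factorial : ℝ≥0∞) *
        ∑ r, ∑ A ∈ (Finset.univ.erase r).powersetCard l,
          ∫⁻ x in Set.Ioi (0 : ℝ), ∫⁻ y in Set.Ioi (0 : ℝ),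
            ∏ i, ENNReal.ofReal (itemFactor A r x y i (w ω i)))) ∂P :=
    lintegral_congr_ae (hpos.mono fun ω h => ofReal_searchCostMoment k (w ω) h)
  have hmA : ∀ l, ∀ r : Fin n, Measurable fun ω => ∑ A ∈ (Finset.univ.erase r).powersetCard l,
      ∫⁻ x in Set.Ioi (0 : ℝ), ∫⁻ y in Set.Ioi (0 : ℝ),
        ∏ i, ENNReal.ofReal (itemFactor A r x y i (w ω i)) := fun l r =>
    Finset.measurable_sum _ fun A _ => hmeas3 A r
  have hmr : ∀ l, Measurable fun ω => ∑ r : Fin n, ∑ A ∈ (Finset.univ.erase r).powersetCard l,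
      ∫⁻ x in Set.Ioi (0 : ℝ), ∫⁻ y in Set.Ioi (0 : ℝ),
        ∏ i, ENNReal.ofReal (itemFactor A r x y i (w ω i)) := fun l =>
    Finset.measurable_sum _ fun r _ => hmA l r
  unfold meanSearchCostMoment
  rw [hae, lintegral_finsetSum _ fun l _ =>
    ((hmr l).const_mul _).const_mul _]
  -- the term `l = 0` vanishes as `k ≥ 1`
  have hIcc : Finset.range (k + 1) = insert 0 (Finset.Icc 1 k) := by
    ext l; simp; omega
  rw [hIcc, Finset.sum_insert (by simp)]
  obtain ⟨k, rfl⟩ := Nat.exists_eq_add_of_le' hk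
  simp only [Nat.stirlingSecond_succ_zero, Nat.cast_zero, zero_mul, lintegral_zero, zero_add]
  refine Finset.sum_congr rfl fun l _ => ?_
  rw [lintegral_const_mul _ ((hmr l).const_mul _), lintegral_const_mul _ (hmr l),
    lintegral_finsetSum _ fun r _ => hmA l r]
  congr 1
  have hcount : ∀ r : Fin n, ∫⁻ ω, ∑ A ∈ (Finset.univ.erase r).powersetCard l,
      (∫⁻ x in Set.Ioi (0 : ℝ), ∫⁻ y in Set.Ioi (0 : ℝ),
        ∏ i, ENNReal.ofReal (itemFactor A r x y i (w ω i))) ∂P =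
      ((n - 1).choose l : ℝ≥0∞) * ∫⁻ x in Set.Ioi (0 : ℝ), ∫⁻ y in Set.Ioi (0 : ℝ),
        L2 (x + y) * L1 x y ^ l * L0 x ^ (n - 1 - l) := by
    intro r
    rw [lintegral_finsetSum _ fun A _ => hmeas3 A r, Finset.sum_congr rfl (hmain l r),
      Finset.sum_const, Finset.card_powersetCard, Finset.card_erase_of_mem (Finset.mem_univ r),
      Finset.card_univ, Fintype.card_fin, nsmul_eq_mul]
  simp only [hcount, Finset.sum_const, Finset.card_univ, Fintype.card_fin, nsmul_eq_mul]
  rw [← mul_assoc, ← mul_assoc]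
  congr 1
  rcases n with _ | n
  · simp
  · rw [Nat.succ_descFactorial_succ, Nat.descFactorial_eq_factorial_mul_choose]
    push_cast
    ring

/-! ### Generalized gamma increments -/

/-- The Laplace exponent `((s + u)^γ - u^γ) / γ` of the generalized gamma subordinator. -/
noncomputable def genGammaExponent (γ u s : ℝ) : ℝ :=
  ((s + u) ^ γ - u ^ γ) / γ

section

variable {γ u : ℝ}

theorem hasDerivAt_genGammaExponent (hγ : 0 < γ) {s : ℝ} (hs : 0 < s + u) :
    HasDerivAt (genGammaExponent γ u) ((s + u) ^ (γ - 1)) s := by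
  have h := (((hasDerivAt_id' s).add_const u).rpow_const (p := γ) (Or.inl hs.ne')).sub_const (u ^ γ)
  refine (h.div_const γ).congr_deriv ?_
  field_simp

theorem hasDerivAt_add_rpow_sub_one {s : ℝ} (hs : 0 < s + u) :
    HasDerivAt (fun s => (s + u) ^ (γ - 1)) ((γ - 1) * (s + u) ^ (γ - 2)) s := by
  have h := ((hasDerivAt_id' s).add_const u).rpow_const (p := γ - 1) (Or.inl hs.ne')
  refine h.congr_deriv ?_
  rw [one_mul, show γ - 1 - 1 = γ - 2 by ring]

theorem genGammaExponent_zero (γ u : ℝ) : genGammaExponent γ u 0 = 0 := by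
  simp [genGammaExponent]

theorem genGammaExponent_mono (hγ : 0 < γ) (hu : 0 ≤ u) {s t : ℝ} (hs : 0 ≤ s) (hst : s ≤ t) :
    genGammaExponent γ u s ≤ genGammaExponent γ u t := by
  unfold genGammaExponent
  gcongr

theorem genGammaExponent_nonneg (hγ : 0 < γ) (hu : 0 ≤ u) {s : ℝ} (hs : 0 ≤ s) :
    0 ≤ genGammaExponent γ u s :=
  genGammaExponent_zero γ u ▸ genGammaExponent_mono hγ hu le_rfl hs

theorem measurable_genGammaExponent (γ u : ℝ) : Measurable (genGammaExponent γ u) := by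
  unfold genGammaExponent
  fun_prop

theorem tendsto_genGammaExponent (hγ : 0 < γ) (u : ℝ) :
    Tendsto (genGammaExponent γ u) atTop atTop := by
  unfold genGammaExponent
  refine Tendsto.atTop_div_const hγ (tendsto_atTop_add_const_right _ (-(u ^ γ)) ?_)
  exact (tendsto_rpow_atTop hγ).comp (tendsto_atTop_add_const_right _ u tendsto_id)

end

section

variable {Ω : Type*} [MeasurableSpace Ω] {P : Measure Ω} [IsProbabilityMeasure P] {X : Ω → ℝ}

theorem integrable_exp_neg_mul (hX : Measurable X) (h0 : ∀ᵐ ω ∂P, 0 ≤ X ω) {s : ℝ} (hs : 0 ≤ s) :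
    Integrable (fun ω => Real.exp (-(s * X ω))) P := by
  refine Integrable.mono' (integrable_const (1 : ℝ)) (by fun_prop) ?_
  filter_upwards [h0] with ω h
  rw [Real.norm_of_nonneg (Real.exp_pos _).le, Real.exp_le_one_iff]
  have := mul_nonneg hs h
  linarith

theorem neg_mem_interior_integrableExpSet (hX : Measurable X) (h0 : ∀ᵐ ω ∂P, 0 ≤ X ω) {s : ℝ}
    (hs : 0 < s) : -s ∈ interior (integrableExpSet X P) := by
  refine mem_interior.2 ⟨Set.Iio 0, fun t ht => ?_, isOpen_Iio, by simpa using hs⟩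
  have := integrable_exp_neg_mul hX h0 (s := -t) (by simpa using le_of_lt ht)
  simpa [integrableExpSet] using this

theorem lintegral_exp_neg_mul (hX : Measurable X) (h0 : ∀ᵐ ω ∂P, 0 ≤ X ω) {φ : ℝ → ℝ}
    (hφ : ∀ s, 0 ≤ s → ∫ ω, Real.exp (-(s * X ω)) ∂P = φ s) {s : ℝ} (hs : 0 ≤ s) :
    ∫⁻ ω, ENNReal.ofReal (Real.exp (-(s * X ω))) ∂P = ENNReal.ofReal (φ s) := by
  rw [← hφ s hs, ofReal_integral_eq_lintegral_ofReal (integrable_exp_neg_mul hX h0 hs)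
    (ae_of_all _ fun ω => (Real.exp_pos _).le)]

theorem lintegral_exp_neg_mul_sub (hX : Measurable X) (h0 : ∀ᵐ ω ∂P, 0 ≤ X ω) {φ : ℝ → ℝ}
    (hφ : ∀ s, 0 ≤ s → ∫ ω, Real.exp (-(s * X ω)) ∂P = φ s) {s t : ℝ} (hs : 0 ≤ s) (ht : s ≤ t) :
    ∫⁻ ω, ENNReal.ofReal (Real.exp (-(s * X ω)) - Real.exp (-(t * X ω))) ∂P =
      ENNReal.ofReal (φ s - φ t) := by
  have hi := integrable_exp_neg_mul hX h0 hs
  have hi' := integrable_exp_neg_mul hX h0 (hs.trans ht)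
  rw [← hφ s hs, ← hφ t (hs.trans ht), ← integral_sub hi hi',
    ofReal_integral_eq_lintegral_ofReal (f := fun ω => _ - _) (hi.sub hi')]
  filter_upwards [h0] with ω h
  simp only [Pi.zero_apply, sub_nonneg, Real.exp_le_exp, neg_le_neg_iff]
  gcongr

/-- A weight with Laplace transform `e^{-bη}`, `η = genGammaExponent γ u`, satisfies
`E[X² e^{-sX}] = (e^{-bη})''(s)`. -/
theorem lintegral_sq_mul_exp_neg_mul {γ u b : ℝ} (hγ : 0 < γ) (hu : 0 ≤ u) (hX : Measurable X)
    (h0 : ∀ᵐ ω ∂P, 0 ≤ X ω)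
    (hφ : ∀ s, 0 ≤ s → ∫ ω, Real.exp (-(s * X ω)) ∂P = Real.exp (-(b * genGammaExponent γ u s)))
    {s : ℝ} (hs : 0 < s) :
    ∫⁻ ω, ENNReal.ofReal (X ω ^ 2 * Real.exp (-(s * X ω))) ∂P =
      ENNReal.ofReal ((b * (1 - γ) * (s + u) ^ (γ - 2) + (b * (s + u) ^ (γ - 1)) ^ 2) *
        Real.exp (-(b * genGammaExponent γ u s))) := by
  have hexp : ∀ s, 0 < s → HasDerivAt (fun s => Real.exp (-(b * genGammaExponent γ u s)))
      (-(b * (s + u) ^ (γ - 1) * Real.exp (-(b * genGammaExponent γ u s)))) s := fun s hs => by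
    have := ((hasDerivAt_genGammaExponent hγ (u := u) (s := s) (by positivity)).const_mul b).fun_neg.exp
    exact this.congr_deriv (by ring)
  -- first derivative
  have h1 : ∀ s, 0 < s → ∫ ω, X ω ^ 1 * Real.exp (-s * X ω) ∂P =
      b * (s + u) ^ (γ - 1) * Real.exp (-(b * genGammaExponent γ u s)) := by
    intro s hs
    have hd := hasDerivAt_integral_pow_mul_exp_real (neg_mem_interior_integrableExpSet hX h0 hs) 0
    have hd' := HasDerivAt.scomp s hd (hasDerivAt_neg s)
    have he : (fun s => Real.exp (-(b * genGammaExponent γ u s))) =ᶠ[𝓝 s]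
        ((fun t => ∫ ω, X ω ^ 0 * Real.exp (t * X ω) ∂P) ∘ Neg.neg) := by
      filter_upwards [eventually_gt_nhds hs] with t ht
      simp [← hφ t ht.le]
    have := (hexp s hs).unique (hd'.congr_of_eventuallyEq he)
    simp only [smul_eq_mul, zero_add] at this
    linarith
  have hd := hasDerivAt_integral_pow_mul_exp_real (neg_mem_interior_integrableExpSet hX h0 hs) 1
  have hd' := HasDerivAt.scomp s hd (hasDerivAt_neg s)
  have he : (fun s => b * (s + u) ^ (γ - 1) * Real.exp (-(b * genGammaExponent γ u s))) =ᶠ[𝓝 s]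
      ((fun t => ∫ ω, X ω ^ 1 * Real.exp (t * X ω) ∂P) ∘ Neg.neg) := by
    filter_upwards [eventually_gt_nhds hs] with t ht
    simp only [Function.comp_apply, h1 t ht]
  have h2 := (((hasDerivAt_add_rpow_sub_one (γ := γ) (u := u) (s := s) (by positivity)).const_mul
    b).mul (hexp s hs)).unique (hd'.congr_of_eventuallyEq he)
  simp only [smul_eq_mul] at h2
  have hint : Integrable (fun ω => X ω ^ 2 * Real.exp (-s * X ω)) P :=
    integrable_pow_mul_exp_of_mem_interior_integrableExpSet
      (neg_mem_interior_integrableExpSet hX h0 hs) 2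
  have h3 : ∫ ω, X ω ^ 2 * Real.exp (-(s * X ω)) ∂P =
      (b * (1 - γ) * (s + u) ^ (γ - 2) + (b * (s + u) ^ (γ - 1)) ^ 2) *
        Real.exp (-(b * genGammaExponent γ u s)) := by
    have e : ∀ ω, Real.exp (-(s * X ω)) = Real.exp (-s * X ω) := fun ω => by rw [neg_mul]
    simp only [e]
    simp only [Nat.reduceAdd] at h2
    linarith
  rw [← h3, ofReal_integral_eq_lintegral_ofReal (by simpa using hint)
    (ae_of_all _ fun ω => by positivity)]

/-- `P(X = 0) ≤ E[e^{-sX}]` for all `s ≥ 0`. -/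
theorem ae_pos_of_integral_exp_neg_tendsto (hX : Measurable X) (h0 : ∀ᵐ ω ∂P, 0 ≤ X ω)
    (h : Tendsto (fun s : ℝ => ∫ ω, Real.exp (-(s * X ω)) ∂P) atTop (𝓝 0)) :
    ∀ᵐ ω ∂P, 0 < X ω := by
  have hle : ∀ s : ℝ, 0 ≤ s → P.real {ω | X ω ≤ 0} ≤ ∫ ω, Real.exp (-(s * X ω)) ∂P := by
    intro s hs
    have hset : {ω | X ω ≤ 0} = X ⁻¹' Set.Iic 0 := rfl
    rw [hset, ← integral_indicator_one (hX measurableSet_Iic)]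
    refine integral_mono_ae ((integrable_const (1 : ℝ)).indicator (hX measurableSet_Iic))
      (integrable_exp_neg_mul hX h0 hs) ?_
    filter_upwards [] with ω
    by_cases hω : ω ∈ X ⁻¹' Set.Iic 0
    · rw [Set.indicator_of_mem hω, Pi.one_apply, Real.one_le_exp_iff]
      have : X ω ≤ 0 := hω
      nlinarith
    · rw [Set.indicator_of_notMem hω]
      exact (Real.exp_pos _).le
  have h1 : P.real {ω | X ω ≤ 0} ≤ 0 :=
    ge_of_tendsto h ((eventually_ge_atTop 0).mono fun s hs => hle s hs)
  have h2 : P {ω | X ω ≤ 0} = 0 := by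
    rwa [← measureReal_eq_zero_iff, ← measureReal_nonneg.ge_iff_eq']
  filter_upwards [measure_eq_zero_iff_ae_notMem.1 h2] with ω hω using not_le.1 hω

end

/-! ### Laplace exponents and the quantities `Ψ(l)` -/

theorem lintegral_rpow_mul_exp_neg_mul {a r : ℝ} (ha : 0 < a) (hr : 0 < r) :
    ∫⁻ y in Set.Ioi (0 : ℝ), ENNReal.ofReal (y ^ (a - 1) * Real.exp (-(r * y))) =
      ENNReal.ofReal ((1 / r) ^ a * Real.Gamma a) := by
  have h := Real.integral_rpow_mul_exp_neg_mul_Ioi ha hr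
  rw [← h, ofReal_integral_eq_lintegral_ofReal]
  · refine Integrable.of_integral_ne_zero ?_
    rw [h]
    have := Real.Gamma_pos_of_pos ha
    positivity
  · filter_upwards [ae_restrict_mem measurableSet_Ioi] with y hy
    have : (0 : ℝ) < y := hy
    positivity

/-- Obtained by writing `e^{-uy} - e^{-(s+u)y} = ∫ y e^{-vy} dv` over `v ∈ (u, s + u)`. -/
theorem laplaceExponent_genGammaLevy {γ u s : ℝ} (hγ : 0 < γ) (hγ1 : γ < 1) (hu : 0 ≤ u)
    (hs : 0 ≤ s) : laplaceExponent (genGammaLevy γ u) s = genGammaExponent γ u s := by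
  have hG : 0 < Real.Gamma (1 - γ) := Real.Gamma_pos_of_pos (by linarith)
  have hdens : Measurable fun y : ℝ =>
      (Real.Gamma (1 - γ))⁻¹ * y ^ (-(1 + γ)) * Real.exp (-(u * y)) := by fun_prop
  have hsupp : ∀ᵐ y ∂(genGammaLevy γ u), 0 < y := by
    refine (withDensity_absolutelyContinuous _ _).ae_le ?_
    exact ae_restrict_mem measurableSet_Ioi
  have hinner : ∀ y : ℝ, 0 < y →
      ENNReal.ofReal ((Real.Gamma (1 - γ))⁻¹ * y ^ (-(1 + γ)) * Real.exp (-(u * y))) *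
        ENNReal.ofReal (1 - Real.exp (-(s * y))) =
      ∫⁻ v in Set.Ioc u (s + u),
        ENNReal.ofReal ((Real.Gamma (1 - γ))⁻¹ * (y ^ ((1 - γ) - 1) * Real.exp (-(v * y)))) := by
    intro y hy
    have hd : ∀ v ∈ Set.uIcc u (s + u), HasDerivAt (fun v =>
        -((Real.Gamma (1 - γ))⁻¹ * y ^ (-(1 + γ)) * Real.exp (-(v * y))))
        ((Real.Gamma (1 - γ))⁻¹ * (y ^ ((1 - γ) - 1) * Real.exp (-(v * y)))) v := by
      intro v _
      have := ((((hasDerivAt_id' v).mul_const y).fun_neg.exp).const_mul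
        ((Real.Gamma (1 - γ))⁻¹ * y ^ (-(1 + γ)))).fun_neg
      refine this.congr_deriv ?_
      have : y ^ ((1 - γ) - 1) = y ^ (-(1 + γ)) * y := by
        rw [← Real.rpow_add_one hy.ne']; ring_nf
      rw [this]; ring
    have hcont : Continuous fun v =>
        (Real.Gamma (1 - γ))⁻¹ * (y ^ ((1 - γ) - 1) * Real.exp (-(v * y))) := by fun_prop
    have hint := intervalIntegral.integral_eq_sub_of_hasDerivAt hd
      (hcont.intervalIntegrable _ _)
    rw [← ENNReal.ofReal_mul (by positivity), ← ofReal_integral_eq_lintegral_ofReal,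
      ← intervalIntegral.integral_of_le (by linarith), hint]
    · congr 1
      rw [show -((s + u) * y) = -(u * y) + -(s * y) by ring, Real.exp_add]
      ring
    · exact (hcont.intervalIntegrable u (s + u)).1
    · exact ae_of_all _ fun v => by positivity
  unfold laplaceExponent
  rw [integral_eq_lintegral_of_nonneg_ae]
  · unfold genGammaLevy
    rw [lintegral_withDensity_eq_lintegral_mul _ (by fun_prop) (by fun_prop)]
    simp only [Pi.mul_apply]
    rw [setLIntegral_congr_fun measurableSet_Ioi fun y hy => hinner y hy,
      lintegral_lintegral_swap]
    · have h1 : ∀ v ∈ Set.Ioc u (s + u), ∫⁻ y in Set.Ioi (0 : ℝ), ENNReal.ofReal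
          ((Real.Gamma (1 - γ))⁻¹ * (y ^ ((1 - γ) - 1) * Real.exp (-(v * y)))) =
          ENNReal.ofReal (v ^ (γ - 1)) := by
        intro v hv
        have hv0 : 0 < v := hu.trans_lt hv.1
        simp only [ENNReal.ofReal_mul (inv_nonneg.2 hG.le)]
        rw [lintegral_const_mul' _ _ ENNReal.ofReal_ne_top,
          lintegral_rpow_mul_exp_neg_mul (by linarith) hv0, ← ENNReal.ofReal_mul (by positivity)]
        congr 1
        rw [one_div, Real.inv_rpow hv0.le, ← Real.rpow_neg hv0.le, neg_sub]
        field_simp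
      rw [setLIntegral_congr_fun measurableSet_Ioc h1, ← ofReal_integral_eq_lintegral_ofReal,
        ← intervalIntegral.integral_of_le (by linarith), integral_rpow (Or.inl (by linarith))]
      · rw [sub_add_cancel, ENNReal.toReal_ofReal]
        · rfl
        · exact genGammaExponent_nonneg hγ hu hs
      · exact (intervalIntegral.intervalIntegrable_rpow' (a := u) (b := s + u)
          (by linarith : -1 < γ - 1)).1
      · filter_upwards [ae_restrict_mem measurableSet_Ioc] with v hv
        have hv0 : 0 < v := hu.trans_lt hv.1
        positivity
    · fun_prop
  · filter_upwards [hsupp] with y hy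
    have := mul_nonneg hs hy.le
    simpa using this
  · fun_prop

/-- The integrand of `Ψ(l)` for the Laplace exponent `c η`, `η = genGammaExponent γ u`. -/
noncomputable def psiIntegrand (γ u c : ℝ) (l : ℕ) (x y : ℝ) : ℝ :=
  (c * (genGammaExponent γ u (x + y) - genGammaExponent γ u x)) ^ l *
    (c * (1 - γ) * (x + y + u) ^ (γ - 2)) * Real.exp (-(c * genGammaExponent γ u x))

theorem measurable_psiIntegrand (γ u c : ℝ) (l : ℕ) :
    Measurable fun q : ℝ × ℝ => psiIntegrand γ u c l q.1 q.2 := by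
  have := measurable_genGammaExponent γ u
  unfold psiIntegrand
  fun_prop

theorem psiIntegrand_nonneg {γ u c : ℝ} (hγ : 0 < γ) (hγ1 : γ < 1) (hu : 0 ≤ u) (hc : 0 ≤ c)
    (l : ℕ) {x y : ℝ} (hx : 0 ≤ x) (hy : 0 ≤ y) : 0 ≤ psiIntegrand γ u c l x y := by
  have h := genGammaExponent_mono hγ hu hx (le_add_of_nonneg_right hy)
  have h1 : 0 < 1 - γ := by linarith
  have h2 := sub_nonneg.2 h
  unfold psiIntegrand
  positivity

/-- Only the values of `ψ` on `[0, ∞)` matter, since the derivatives are taken at positive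
points. -/
theorem limitPsi_eq_lintegral {γ u c : ℝ} (hγ : 0 < γ) (hu : 0 ≤ u) {ψ : ℝ → ℝ}
    (hψ : ∀ s, 0 ≤ s → ψ s = c * genGammaExponent γ u s) (l : ℕ) :
    limitPsi ψ l = ∫⁻ x in Set.Ioi (0 : ℝ), ∫⁻ y in Set.Ioi (0 : ℝ),
      ENNReal.ofReal (psiIntegrand γ u c l x y) := by
  have hd1 : ∀ s, 0 < s → deriv ψ s = c * (s + u) ^ (γ - 1) := by
    intro s hs
    have he : ψ =ᶠ[𝓝 s] fun s => c * genGammaExponent γ u s :=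
      (eventually_gt_nhds hs).mono fun t ht => hψ t ht.le
    rw [he.deriv_eq]
    exact ((hasDerivAt_genGammaExponent hγ (by positivity)).const_mul c).deriv
  have hd2 : ∀ s, 0 < s → deriv (deriv ψ) s = c * ((γ - 1) * (s + u) ^ (γ - 2)) := by
    intro s hs
    have he : deriv ψ =ᶠ[𝓝 s] fun s => c * (s + u) ^ (γ - 1) :=
      (eventually_gt_nhds hs).mono fun t ht => hd1 t ht
    rw [he.deriv_eq]
    exact ((hasDerivAt_add_rpow_sub_one (by positivity)).const_mul c).deriv
  unfold limitPsi
  rw [lintegral_lintegral_swap (μ := volume.restrict (Set.Ioi (0 : ℝ)))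
    (f := fun x y => ENNReal.ofReal (psiIntegrand γ u c l x y))
    ((ENNReal.measurable_ofReal.comp (measurable_psiIntegrand γ u c l)).aemeasurable)]
  refine setLIntegral_congr_fun measurableSet_Ioi fun y hy =>
    setLIntegral_congr_fun measurableSet_Ioi fun x hx => ?_
  have hx0 : (0 : ℝ) < x := hx
  have hy0 : (0 : ℝ) < y := hy
  rw [hd2 (x + y) (by positivity), hψ x hx0.le, hψ (x + y) (by positivity), psiIntegrand]
  congr 1
  ring

theorem Real.Gamma_add_natCast {α : ℝ} (hα : 0 < α) (n : ℕ) :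
    Real.Gamma (α + n) = (ascPochhammer ℝ n).eval α * Real.Gamma α := by
  induction n with
  | zero => simp
  | succ n ih =>
    have h : α + (n + 1 : ℕ) = (α + n) + 1 := by push_cast; ring
    rw [h, Real.Gamma_add_one (by positivity), ih, ascPochhammer_succ_eval]
    ring

theorem one_div_sub_pos {γ : ℝ} (hγ : 0 < γ) {l : ℕ} (h : γ < 1 / ((l : ℝ) + 1)) :
    0 < 1 / γ - l - 1 := by
  rw [lt_div_iff₀ (by positivity)] at h
  have : (l : ℝ) + 1 < 1 / γ := by rw [lt_div_iff₀ hγ]; linarith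
  linarith

/-- The substitution `w = ((a + y) / a)^{-γ}`. -/
theorem lintegral_rpow_sub_pow_eq {γ a : ℝ} (hγ : 0 < γ) (ha : 0 < a) (l : ℕ) :
    ∫⁻ y in Set.Ioi (0 : ℝ), ENNReal.ofReal (((a + y) ^ γ - a ^ γ) ^ l * (a + y) ^ (γ - 2)) =
      ENNReal.ofReal (a ^ ((l + 1) * γ - 1) / γ) *
        ∫⁻ w in Set.Ioo (0 : ℝ) 1, ENNReal.ofReal (w ^ (1 / γ - l - 1 - 1) * (1 - w) ^ l) := by
  have himg : (fun w : ℝ => a * w ^ (-(1 / γ)) - a) '' Set.Ioo 0 1 = Set.Ioi 0 := by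
    ext y
    simp only [Set.mem_image, Set.mem_Ioo, Set.mem_Ioi]
    constructor
    · rintro ⟨w, ⟨hw0, hw1⟩, rfl⟩
      have := Real.one_lt_rpow_of_pos_of_lt_one_of_neg hw0 hw1
        (neg_lt_zero.2 (one_div_pos.2 hγ))
      nlinarith
    · intro hy
      have h1 : 1 < (a + y) / a := by rw [lt_div_iff₀ ha]; linarith
      have h0 : 0 < (a + y) / a := by positivity
      refine ⟨((a + y) / a) ^ (-γ), ⟨by positivity,
        Real.rpow_lt_one_of_one_lt_of_neg h1 (neg_lt_zero.2 hγ)⟩, ?_⟩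
      rw [← Real.rpow_mul h0.le, show -γ * -(1 / γ) = 1 by field_simp, Real.rpow_one]
      field_simp
      ring
  have hder : ∀ w ∈ Set.Ioo (0 : ℝ) 1, HasDerivWithinAt (fun w : ℝ => a * w ^ (-(1 / γ)) - a)
      (a * (-(1 / γ) * w ^ (-(1 / γ) - 1))) (Set.Ioo 0 1) w := fun w hw =>
    (((Real.hasDerivAt_rpow_const (Or.inl hw.1.ne')).const_mul a).sub_const a).hasDerivWithinAt
  have hinj : Set.InjOn (fun w : ℝ => a * w ^ (-(1 / γ)) - a) (Set.Ioo 0 1) := by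
    intro w hw w' hw' h
    have h' : w ^ (-(1 / γ)) = w' ^ (-(1 / γ)) := by
      have h : a * w ^ (-(1 / γ)) - a = a * w' ^ (-(1 / γ)) - a := h
      exact mul_left_cancel₀ ha.ne' (by linarith)
    exact (Real.rpow_left_inj hw.1.le hw'.1.le (by
      have := one_div_pos.2 hγ; linarith)).1 h'
  rw [← himg, lintegral_image_eq_lintegral_abs_deriv_mul measurableSet_Ioo hder hinj,
    ← lintegral_const_mul' _ _ ENNReal.ofReal_ne_top]
  refine setLIntegral_congr_fun measurableSet_Ioo fun w hw => ?_
  have hw0 : 0 < w := hw.1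
  have h1w : 0 < 1 - w := by linarith [hw.2]
  rw [← ENNReal.ofReal_mul (abs_nonneg _), ← ENNReal.ofReal_mul (by positivity)]
  congr 1
  have e1 : |a * (-(1 / γ) * w ^ (-(1 / γ) - 1))| = a / γ * w ^ (-(1 / γ) - 1) := by
    rw [show a * (-(1 / γ) * w ^ (-(1 / γ) - 1)) = -(a / γ * w ^ (-(1 / γ) - 1)) by ring, abs_neg,
      abs_of_pos (by positivity)]
  have e2 : a + (a * w ^ (-(1 / γ)) - a) = a * w ^ (-(1 / γ)) := by ring
  have e3 : (a * w ^ (-(1 / γ))) ^ γ - a ^ γ = a ^ γ * (w⁻¹ * (1 - w)) := by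
    rw [Real.mul_rpow ha.le (by positivity), ← Real.rpow_mul hw0.le,
      show -(1 / γ) * γ = -1 by field_simp, Real.rpow_neg_one]
    field_simp
  have e4 : (a * w ^ (-(1 / γ))) ^ (γ - 2) = a ^ (γ - 2) * w ^ (2 / γ - 1) := by
    rw [Real.mul_rpow ha.le (by positivity), ← Real.rpow_mul hw0.le]
    congr 2
    field_simp
    ring
  rw [e1, e2, e3, e4, mul_pow, mul_pow]
  have e5 : a ^ ((l + 1) * γ - 1) = a * (a ^ γ) ^ l * a ^ (γ - 2) := by
    rw [← Real.rpow_natCast (a ^ γ), ← Real.rpow_mul ha.le]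
    conv_rhs => rw [← Real.rpow_one a]
    rw [← Real.rpow_mul ha.le, ← Real.rpow_mul ha.le, ← Real.rpow_add ha, ← Real.rpow_add ha]
    congr 1
    ring
  have e6 : w ^ (1 / γ - l - 1 - 1) = w ^ (-(1 / γ) - 1) * w⁻¹ ^ l * w ^ (2 / γ - 1) := by
    rw [inv_pow, ← Real.rpow_natCast w l, ← Real.rpow_neg hw0.le, ← Real.rpow_add hw0,
      ← Real.rpow_add hw0]
    congr 1
    ring
  rw [e5, e6]
  ring

theorem lintegral_beta_of_lt {γ : ℝ} (hγ : 0 < γ) (hγ1 : γ < 1) {l : ℕ}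
    (h : γ < 1 / ((l : ℝ) + 1)) :
    ∫⁻ w in Set.Ioo (0 : ℝ) 1, ENNReal.ofReal (w ^ (1 / γ - l - 1 - 1) * (1 - w) ^ l) =
      ENNReal.ofReal (γ * l.factorial /
        ((1 - γ) * (ascPochhammer ℝ l).eval (1 / γ - l - 1))) := by
  have hα := one_div_sub_pos hγ h
  have hl : (0 : ℝ) < l + 1 := by positivity
  have hB := beta_pos hα hl
  have key := lintegral_betaPDF_eq_one hα hl
  rw [lintegral_betaPDF] at key
  have e : ∀ w ∈ Set.Ioo (0 : ℝ) 1, ENNReal.ofReal (w ^ (1 / γ - l - 1 - 1) * (1 - w) ^ l) =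
      ENNReal.ofReal (beta (1 / γ - l - 1) (l + 1)) * ENNReal.ofReal (1 / beta (1 / γ - l - 1) (l + 1)
        * w ^ (1 / γ - l - 1 - 1) * (1 - w) ^ ((l + 1 : ℝ) - 1)) := by
    intro w hw
    rw [← ENNReal.ofReal_mul hB.le, add_sub_cancel_right, Real.rpow_natCast, mul_assoc, ← mul_assoc,
      mul_one_div_cancel hB.ne', one_mul]
  rw [setLIntegral_congr_fun measurableSet_Ioo e, lintegral_const_mul' _ _ ENNReal.ofReal_ne_top, key,
    mul_one]
  congr 1
  have h1 : 1 / γ - l - 1 + (l + 1) = (1 / γ - l - 1) + (l + 1 : ℕ) := by push_cast; ring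
  rw [beta, h1, Real.Gamma_add_natCast hα, Real.Gamma_nat_eq_factorial, ascPochhammer_succ_eval]
  have h2 := Real.Gamma_pos_of_pos hα
  have h3 := ascPochhammer_pos l _ hα
  have h4 : 1 / γ - l - 1 + l = (1 - γ) / γ := by field_simp; ring
  have h5 : 1 - γ ≠ 0 := by linarith
  rw [h4]
  generalize 1 / γ - l - 1 = α at *
  field_simp

/-- The exponent of `w` is at most `-1`, so that the integral diverges at `0`. -/
theorem lintegral_beta_of_ge {γ : ℝ} (hγ : 0 < γ) {l : ℕ} (h : 1 / ((l : ℝ) + 1) ≤ γ) :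
    ∫⁻ w in Set.Ioo (0 : ℝ) 1, ENNReal.ofReal (w ^ (1 / γ - l - 1 - 1) * (1 - w) ^ l) = ⊤ := by
  have hα : 1 / γ - l - 1 - 1 ≤ -1 := by
    rw [div_le_iff₀ (by positivity)] at h
    have : 1 / γ ≤ (l : ℝ) + 1 := by rw [div_le_iff₀ hγ]; linarith
    linarith
  set s := 1 / γ - l - 1 - 1
  have hdiv : ∫⁻ w in Set.Ioo (0 : ℝ) (1 / 2), ENNReal.ofReal (w ^ s) = ⊤ := by
    by_contra hne
    have hI : IntegrableOn (fun w : ℝ => w ^ s) (Set.Ioo 0 (1 / 2)) := by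
      refine ⟨by fun_prop, ?_⟩
      rw [hasFiniteIntegral_iff_ofReal]
      · exact lt_top_iff_ne_top.2 hne
      · filter_upwards [ae_restrict_mem measurableSet_Ioo] with w hw
        exact Real.rpow_nonneg hw.1.le _
    rw [intervalIntegral.integrableOn_Ioo_rpow_iff (by norm_num)] at hI
    linarith
  rw [eq_top_iff]
  calc ⊤ = ENNReal.ofReal ((1 / 2) ^ l) *
        ∫⁻ w in Set.Ioo (0 : ℝ) (1 / 2), ENNReal.ofReal (w ^ s) := by
        rw [hdiv, ENNReal.mul_top]
        simp
    _ = ∫⁻ w in Set.Ioo (0 : ℝ) (1 / 2), ENNReal.ofReal ((1 / 2) ^ l) * ENNReal.ofReal (w ^ s) := by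
        rw [lintegral_const_mul' _ _ ENNReal.ofReal_ne_top]
    _ ≤ ∫⁻ w in Set.Ioo (0 : ℝ) (1 / 2), ENNReal.ofReal (w ^ s * (1 - w) ^ l) := by
        refine setLIntegral_mono' measurableSet_Ioo fun w hw => ?_
        rw [← ENNReal.ofReal_mul (by positivity), mul_comm]
        have : 0 < w := hw.1
        have : w < 1 / 2 := hw.2
        gcongr
        linarith
    _ ≤ _ := lintegral_mono_set (Set.Ioo_subset_Ioo_right (by norm_num))

theorem lintegral_psiIntegrand_inner {γ u c x : ℝ} (hγ : 0 < γ) (hγ1 : γ < 1) (hu : 0 ≤ u)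
    (hc : 0 < c) (hx : 0 < x) (l : ℕ) :
    ∫⁻ y in Set.Ioi (0 : ℝ), ENNReal.ofReal (psiIntegrand γ u c l x y) =
      ENNReal.ofReal ((1 - γ) / γ * (c ^ (l + 1) * γ⁻¹ ^ l * (x + u) ^ ((l + 1) * γ - 1) *
        Real.exp (-(c * genGammaExponent γ u x)))) *
        ∫⁻ w in Set.Ioo (0 : ℝ) 1, ENNReal.ofReal (w ^ (1 / γ - l - 1 - 1) * (1 - w) ^ l) := by
  have ha : 0 < x + u := by positivity
  have h1γ : 0 < 1 - γ := by linarith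
  have e : ∀ y ∈ Set.Ioi (0 : ℝ), ENNReal.ofReal (psiIntegrand γ u c l x y) =
      ENNReal.ofReal ((1 - γ) * (c ^ (l + 1) * γ⁻¹ ^ l *
        Real.exp (-(c * genGammaExponent γ u x)))) *
      ENNReal.ofReal (((x + u + y) ^ γ - (x + u) ^ γ) ^ l * (x + u + y) ^ (γ - 2)) := by
    intro y _
    rw [← ENNReal.ofReal_mul (by positivity)]
    congr 1
    rw [psiIntegrand, genGammaExponent, genGammaExponent, add_right_comm x y u,
      show c * (((x + u + y) ^ γ - u ^ γ) / γ - ((x + u) ^ γ - u ^ γ) / γ) =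
        c * γ⁻¹ * ((x + u + y) ^ γ - (x + u) ^ γ) by ring, mul_pow, mul_pow]
    ring
  rw [setLIntegral_congr_fun measurableSet_Ioi e, lintegral_const_mul' _ _ ENNReal.ofReal_ne_top,
    lintegral_rpow_sub_pow_eq hγ ha, ← mul_assoc, ← ENNReal.ofReal_mul (by positivity)]
  congr 2
  field_simp

/-- The factorial times the truncated exponential series, `∑_{m ≤ j} j! / m! t^m`, which is
`∫ (s + t)^j e^{-s} ds` over `s > 0`. -/
noncomputable def truncatedExp (j : ℕ) (t : ℝ) : ℝ :=
  j.factorial * ∑ m ∈ Finset.range (j + 1), t ^ m / m.factorial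

theorem truncatedExp_nonneg (j : ℕ) {t : ℝ} (ht : 0 ≤ t) : 0 ≤ truncatedExp j t := by
  unfold truncatedExp
  positivity

theorem lintegral_add_pow_mul_exp_neg {t : ℝ} (ht : 0 ≤ t) (j : ℕ) :
    ∫⁻ s in Set.Ioi (0 : ℝ), ENNReal.ofReal ((s + t) ^ j * Real.exp (-s)) =
      ENNReal.ofReal (truncatedExp j t) := by
  have e : ∀ s ∈ Set.Ioi (0 : ℝ), ENNReal.ofReal ((s + t) ^ j * Real.exp (-s)) =
      ∑ m ∈ Finset.range (j + 1), ENNReal.ofReal (t ^ m * j.choose m) *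
        ENNReal.ofReal (s ^ (((j - m : ℕ) + 1 : ℝ) - 1) * Real.exp (-(1 * s))) := by
    intro s hs
    have hs0 : (0 : ℝ) < s := hs
    rw [add_comm s t, add_pow, Finset.sum_mul, ENNReal.ofReal_sum_of_nonneg]
    · refine Finset.sum_congr rfl fun m _ => ?_
      rw [← ENNReal.ofReal_mul (by positivity), add_sub_cancel_right, Real.rpow_natCast, one_mul]
      congr 1
      ring
    · intro m _
      positivity
  rw [setLIntegral_congr_fun measurableSet_Ioi e, lintegral_finsetSum' _ fun m _ => by fun_prop]
  have e2 : ∀ m ∈ Finset.range (j + 1), ∫⁻ s in Set.Ioi (0 : ℝ), ENNReal.ofReal (t ^ m * j.choose m) *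
      ENNReal.ofReal (s ^ (((j - m : ℕ) + 1 : ℝ) - 1) * Real.exp (-(1 * s))) =
      ENNReal.ofReal (j.factorial * (t ^ m / m.factorial)) := by
    intro m hm
    rw [lintegral_const_mul' _ _ ENNReal.ofReal_ne_top,
      lintegral_rpow_mul_exp_neg_mul (by positivity) one_pos, ← ENNReal.ofReal_mul (by positivity),
      Real.Gamma_nat_eq_factorial]
    congr 1
    have := Nat.choose_mul_factorial_mul_factorial (Nat.lt_succ_iff.1 (Finset.mem_range.1 hm))
    have hR : (j.choose m : ℝ) * m.factorial * (j - m).factorial = j.factorial := by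
      exact_mod_cast this
    rw [← hR]
    simp
    field_simp
  rw [Finset.sum_congr rfl e2, ← ENNReal.ofReal_sum_of_nonneg fun m _ => by positivity,
    truncatedExp, Finset.mul_sum]

/-- The substitution `t = c η(x)`. -/
theorem lintegral_rpow_mul_exp_neg_genGammaExponent {γ u c : ℝ} (hγ : 0 < γ) (hu : 0 ≤ u)
    (hc : 0 < c) (j : ℕ) :
    ∫⁻ x in Set.Ioi (0 : ℝ), ENNReal.ofReal (c ^ (j + 1) * γ⁻¹ ^ j * (x + u) ^ ((j + 1) * γ - 1) *
        Real.exp (-(c * genGammaExponent γ u x))) =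
      ENNReal.ofReal (truncatedExp j (c * u ^ γ / γ)) := by
  have himg : (fun x => c * genGammaExponent γ u x) '' Set.Ioi 0 = Set.Ioi 0 := by
    ext t
    simp only [Set.mem_image, Set.mem_Ioi]
    constructor
    · rintro ⟨x, hx, rfl⟩
      have : u ^ γ < (x + u) ^ γ := Real.rpow_lt_rpow hu (by linarith) hγ
      have : 0 < genGammaExponent γ u x := div_pos (by linarith) hγ
      positivity
    · intro ht
      have h1 : 0 < γ * t / c + u ^ γ := by positivity
      refine ⟨(γ * t / c + u ^ γ) ^ (1 / γ) - u, ?_, ?_⟩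
      · have h2 : (u ^ γ) ^ (1 / γ) < (γ * t / c + u ^ γ) ^ (1 / γ) :=
          Real.rpow_lt_rpow (by positivity) (by
            have : 0 < γ * t / c := by positivity
            linarith) (by positivity)
        rw [← Real.rpow_mul hu, mul_one_div_cancel hγ.ne', Real.rpow_one] at h2
        linarith
      · rw [genGammaExponent, sub_add_cancel, ← Real.rpow_mul h1.le, one_div_mul_cancel hγ.ne',
          Real.rpow_one]
        field_simp
        ring
  have hder : ∀ x ∈ Set.Ioi (0 : ℝ), HasDerivWithinAt (fun x => c * genGammaExponent γ u x)
      (c * (x + u) ^ (γ - 1)) (Set.Ioi 0) x := fun x hx => by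
    have hx0 : (0 : ℝ) < x := hx
    exact ((hasDerivAt_genGammaExponent hγ (by positivity)).const_mul c).hasDerivWithinAt
  have hmono : MonotoneOn (fun x => c * genGammaExponent γ u x) (Set.Ioi 0) := fun x hx y _ hxy =>
    mul_le_mul_of_nonneg_left (genGammaExponent_mono hγ hu (le_of_lt hx) hxy) hc.le
  have key := lintegral_image_eq_lintegral_deriv_mul_of_monotoneOn measurableSet_Ioi hder hmono
    fun s => ENNReal.ofReal ((s + c * u ^ γ / γ) ^ j * Real.exp (-s))
  rw [himg] at key
  rw [← lintegral_add_pow_mul_exp_neg (by positivity), key]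
  refine setLIntegral_congr_fun measurableSet_Ioi fun x hx => ?_
  have hx0 : (0 : ℝ) < x := hx
  have ha : 0 < x + u := by positivity
  rw [← ENNReal.ofReal_mul (by positivity)]
  congr 1
  have e1 : c * genGammaExponent γ u x + c * u ^ γ / γ = c * γ⁻¹ * (x + u) ^ γ := by
    rw [genGammaExponent]; field_simp; ring
  have e2 : (x + u) ^ ((j + 1) * γ - 1) = (x + u) ^ (γ - 1) * ((x + u) ^ γ) ^ j := by
    rw [← Real.rpow_natCast ((x + u) ^ γ), ← Real.rpow_mul ha.le, ← Real.rpow_add ha]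
    congr 1
    ring
  rw [e1, e2, mul_pow, mul_pow]
  ring

theorem lintegral_psiIntegrand {γ u c : ℝ} (hγ : 0 < γ) (hγ1 : γ < 1) (hu : 0 ≤ u) (hc : 0 < c)
    {l : ℕ} (h : γ < 1 / ((l : ℝ) + 1)) :
    ∫⁻ x in Set.Ioi (0 : ℝ), ∫⁻ y in Set.Ioi (0 : ℝ), ENNReal.ofReal (psiIntegrand γ u c l x y) =
      ENNReal.ofReal (l.factorial / (ascPochhammer ℝ l).eval (1 / γ - l - 1) *
        truncatedExp l (c * u ^ γ / γ)) := by
  have h1γ : 0 < 1 - γ := by linarith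
  have hK := ascPochhammer_pos l _ (one_div_sub_pos hγ h)
  have e : ∀ x ∈ Set.Ioi (0 : ℝ), ∫⁻ y in Set.Ioi (0 : ℝ),
      ENNReal.ofReal (psiIntegrand γ u c l x y) =
      ENNReal.ofReal (l.factorial / (ascPochhammer ℝ l).eval (1 / γ - l - 1)) *
        ENNReal.ofReal (c ^ (l + 1) * γ⁻¹ ^ l * (x + u) ^ ((l + 1) * γ - 1) *
          Real.exp (-(c * genGammaExponent γ u x))) := by
    intro x hx
    have hx0 : (0 : ℝ) < x := hx
    rw [lintegral_psiIntegrand_inner hγ hγ1 hu hc hx, lintegral_beta_of_lt hγ hγ1 h,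
      ← ENNReal.ofReal_mul (by positivity), ← ENNReal.ofReal_mul (by positivity)]
    congr 1
    generalize 1 / γ - l - 1 = α at *
    field_simp
  rw [setLIntegral_congr_fun measurableSet_Ioi e, lintegral_const_mul' _ _ ENNReal.ofReal_ne_top,
    lintegral_rpow_mul_exp_neg_genGammaExponent hγ hu hc, ← ENNReal.ofReal_mul (by positivity)]

/-- The integral of the function that dominates the integrands for finitely many items. The
additional factor `1 + c (x + u)^γ` raises the power of `x + u` in the outer integral only, so that
the condition on `γ` is the same as for `Ψ(l)`. -/
theorem lintegral_psiIntegrand_mul {γ u c : ℝ} (hγ : 0 < γ) (hγ1 : γ < 1) (hu : 0 ≤ u)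
    (hc : 0 < c) {l : ℕ} (h : γ < 1 / ((l : ℝ) + 1)) :
    ∫⁻ x in Set.Ioi (0 : ℝ), ∫⁻ y in Set.Ioi (0 : ℝ),
        ENNReal.ofReal (psiIntegrand γ u c l x y * (1 + c * (x + u) ^ γ)) =
      ENNReal.ofReal (l.factorial / (ascPochhammer ℝ l).eval (1 / γ - l - 1) *
        (truncatedExp l (c * u ^ γ / γ) + γ * truncatedExp (l + 1) (c * u ^ γ / γ))) := by
  have h1γ : 0 < 1 - γ := by linarith
  have hK := ascPochhammer_pos l _ (one_div_sub_pos hγ h)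
  have ht : 0 ≤ c * u ^ γ / γ := by positivity
  have e : ∀ x ∈ Set.Ioi (0 : ℝ), ∫⁻ y in Set.Ioi (0 : ℝ),
      ENNReal.ofReal (psiIntegrand γ u c l x y * (1 + c * (x + u) ^ γ)) =
      ENNReal.ofReal (l.factorial / (ascPochhammer ℝ l).eval (1 / γ - l - 1)) *
        (ENNReal.ofReal (c ^ (l + 1) * γ⁻¹ ^ l * (x + u) ^ ((l + 1) * γ - 1) *
          Real.exp (-(c * genGammaExponent γ u x))) + ENNReal.ofReal γ *
        ENNReal.ofReal (c ^ (l + 1 + 1) * γ⁻¹ ^ (l + 1) * (x + u) ^ (((l + 1 : ℕ) + 1) * γ - 1) *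
          Real.exp (-(c * genGammaExponent γ u x)))) := by
    intro x hx
    have hx0 : (0 : ℝ) < x := hx
    have ha : 0 < x + u := by positivity
    have hw : 0 ≤ 1 + c * (x + u) ^ γ := by positivity
    simp only [ENNReal.ofReal_mul' hw]
    rw [lintegral_mul_const' _ _ ENNReal.ofReal_ne_top,
      lintegral_psiIntegrand_inner hγ hγ1 hu hc hx, lintegral_beta_of_lt hγ hγ1 h,
      ← ENNReal.ofReal_mul (by positivity), ← ENNReal.ofReal_mul (by positivity),
      ← ENNReal.ofReal_mul (by positivity), ← ENNReal.ofReal_add (by positivity) (by positivity),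
      ← ENNReal.ofReal_mul (by positivity)]
    congr 1
    have e2 : (x + u) ^ (((l + 1 : ℕ) + 1) * γ - 1) = (x + u) ^ ((l + 1) * γ - 1) * (x + u) ^ γ := by
      rw [← Real.rpow_add ha]
      congr 1
      push_cast
      ring
    rw [e2, pow_succ γ⁻¹ l, pow_succ c (l + 1)]
    generalize 1 / γ - l - 1 = α at *
    field_simp
  have hm := measurable_genGammaExponent γ u
  rw [setLIntegral_congr_fun measurableSet_Ioi e, lintegral_const_mul' _ _ ENNReal.ofReal_ne_top,
    lintegral_add_left (by fun_prop), lintegral_const_mul' _ _ ENNReal.ofReal_ne_top,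
    lintegral_rpow_mul_exp_neg_genGammaExponent hγ hu hc,
    lintegral_rpow_mul_exp_neg_genGammaExponent hγ hu hc, ← ENNReal.ofReal_mul hγ.le,
    ← ENNReal.ofReal_add (truncatedExp_nonneg l ht) (mul_nonneg hγ.le (truncatedExp_nonneg _ ht)),
    ← ENNReal.ofReal_mul (by positivity)]

theorem lintegral_psiIntegrand_eq_top {γ u c : ℝ} (hγ : 0 < γ) (hγ1 : γ < 1) (hu : 0 ≤ u)
    (hc : 0 < c) {l : ℕ} (h : 1 / ((l : ℝ) + 1) ≤ γ) :
    ∫⁻ x in Set.Ioi (0 : ℝ), ∫⁻ y in Set.Ioi (0 : ℝ),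
      ENNReal.ofReal (psiIntegrand γ u c l x y) = ⊤ := by
  have h1γ : 0 < 1 - γ := by linarith
  have e : ∀ x ∈ Set.Ioi (0 : ℝ), ∫⁻ y in Set.Ioi (0 : ℝ),
      ENNReal.ofReal (psiIntegrand γ u c l x y) = ⊤ := by
    intro x hx
    have hx0 : (0 : ℝ) < x := hx
    rw [lintegral_psiIntegrand_inner hγ hγ1 hu hc hx, lintegral_beta_of_ge hγ h, ENNReal.mul_top]
    rw [ENNReal.ofReal_ne_zero_iff]
    positivity
  rw [setLIntegral_congr_fun measurableSet_Ioi e]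
  simp

/-! ### The limit of the factorial moments -/

/-- The integrand of the `l`-th factorial moment of the search cost of `n` items whose weights have
the Laplace transform `e^{-cη/n}`, `η = genGammaExponent γ u`. -/
noncomputable def factorialMomentIntegrand (γ u c : ℝ) (l n : ℕ) (x y : ℝ) : ℝ :=
  n.descFactorial (l + 1) *
    ((c / n * (1 - γ) * (x + y + u) ^ (γ - 2) + (c / n * (x + y + u) ^ (γ - 1)) ^ 2) *
      Real.exp (-(c / n * genGammaExponent γ u (x + y)))) *
    (Real.exp (-(c / n * genGammaExponent γ u x)) -
      Real.exp (-(c / n * genGammaExponent γ u (x + y)))) ^ l *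
    Real.exp (-(c / n * genGammaExponent γ u x)) ^ (n - 1 - l)

theorem measurable_factorialMomentIntegrand_prod (γ u : ℝ) (l n : ℕ) :
    Measurable fun q : ℝ × ℝ × ℝ => factorialMomentIntegrand γ u q.1 l n q.2.1 q.2.2 := by
  have := measurable_genGammaExponent γ u
  unfold factorialMomentIntegrand
  fun_prop

theorem measurable_factorialMomentIntegrand (γ u c : ℝ) (l n : ℕ) :
    Measurable fun q : ℝ × ℝ => factorialMomentIntegrand γ u c l n q.1 q.2 :=
  (measurable_factorialMomentIntegrand_prod γ u l n).comp measurable_prodMk_left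

/-- The square of the first derivative of the exponent, which comes from the second derivative of
`e^{-cη/n}`, is `O(v^{2γ-2})` and alone would not be integrable against `v^{lγ}`. The factor
`e^{-cη/n}` compensates for it: `b v^γ e^{-bΔ} ≤ γ + c a^γ` for `b = c / n`, `a = x + u`,
`v = a + y` and `v^γ = γ Δ + a^γ`. -/
theorem factorialMomentIntegrand_le {γ u c : ℝ} (hγ : 0 < γ) (hγ1 : γ < 1) (hu : 0 ≤ u)
    (hc : 0 < c) (l n : ℕ) {x y : ℝ} (hx : 0 < x) (hy : 0 < y) :
    factorialMomentIntegrand γ u c l n x y ≤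
      (1 - γ)⁻¹ * (psiIntegrand γ u c l x y * (1 + c * (x + u) ^ γ)) := by
  have h1γ : 0 < 1 - γ := by linarith
  have hpsi := psiIntegrand_nonneg hγ hγ1 hu hc.le l hx.le hy.le
  rcases lt_or_ge n (l + 1) with hn | hn
  · rw [factorialMomentIntegrand, Nat.descFactorial_eq_zero_iff_lt.2 hn]
    simp only [Nat.cast_zero, zero_mul]
    positivity
  have hn0 : 0 < (n : ℝ) := by exact_mod_cast (by omega : 0 < n)
  have hn1 : 1 ≤ (n : ℝ) := by exact_mod_cast (by omega : 1 ≤ n)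
  have hmono := genGammaExponent_mono hγ hu hx.le (le_add_of_nonneg_right hy.le)
  have hv : 0 < x + y + u := by positivity
  have hvγ : (x + y + u) ^ γ = γ * (genGammaExponent γ u (x + y) - genGammaExponent γ u x) +
      (x + u) ^ γ := by
    simp only [genGammaExponent]; field_simp; ring
  have hsq : ((x + y + u) ^ (γ - 1)) ^ 2 = (x + y + u) ^ (γ - 2) * (x + y + u) ^ γ := by
    rw [← Real.rpow_natCast, ← Real.rpow_mul hv.le, ← Real.rpow_add hv]
    congr 1
    push_cast
    ring
  unfold factorialMomentIntegrand psiIntegrand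
  set E := genGammaExponent γ u x
  obtain ⟨Δ, hΔ⟩ : ∃ Δ, genGammaExponent γ u (x + y) = E + Δ := ⟨_, (add_sub_cancel _ _).symm⟩
  rw [hΔ] at hmono hvγ ⊢
  have hΔ0 : 0 ≤ Δ := by linarith
  set q := (x + y + u) ^ (γ - 2)
  have hq : 0 < q := by positivity
  set b := c / n
  have hb : 0 < b := by positivity
  have hbc : b ≤ c := div_le_self hc.le hn1
  have haγ : 0 < (x + u) ^ γ := by positivity
  rw [add_sub_cancel_left] at hvγ ⊢
  have hsplit : Real.exp (-(b * (E + Δ))) = Real.exp (-(b * E)) * Real.exp (-(b * Δ)) := by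
    rw [← Real.exp_add]; ring_nf
  have hbΔ : 0 ≤ b * Δ := by positivity
  have he1 : Real.exp (-(b * Δ)) ≤ 1 := by simpa using hbΔ
  have claim1 : (b * (1 - γ) * q + (b * (x + y + u) ^ (γ - 1)) ^ 2) * Real.exp (-(b * Δ)) ≤
      b * q * (1 + c * (x + u) ^ γ) := by
    rw [mul_pow, hsq, hvγ]
    have h2 : b * Δ * Real.exp (-(b * Δ)) ≤ 1 := by
      rw [Real.exp_neg, ← div_eq_mul_inv, div_le_one (Real.exp_pos _)]
      linarith [Real.add_one_le_exp (b * Δ)]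
    have h3 : b * Real.exp (-(b * Δ)) ≤ c :=
      (mul_le_of_le_one_right hb.le he1).trans hbc
    have h4 : (1 - γ) * Real.exp (-(b * Δ)) + γ * (b * Δ * Real.exp (-(b * Δ))) +
        (b * Real.exp (-(b * Δ))) * (x + u) ^ γ ≤ 1 + c * (x + u) ^ γ := by
      have := mul_le_mul_of_nonneg_right h3 haγ.le
      have := mul_le_mul_of_nonneg_left he1 h1γ.le
      have := mul_le_mul_of_nonneg_left h2 hγ.le
      linarith
    have := mul_le_mul_of_nonneg_left h4 (mul_pos hb hq).le
    linarith
  have claim2 : Real.exp (-(b * E)) - Real.exp (-(b * (E + Δ))) ≤ Real.exp (-(b * E)) * (b * Δ) := by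
    rw [hsplit]
    have := Real.add_one_le_exp (-(b * Δ))
    have := mul_le_mul_of_nonneg_left (show 1 - Real.exp (-(b * Δ)) ≤ b * Δ by linarith)
      (Real.exp_pos (-(b * E))).le
    linarith
  have claim2' : 0 ≤ Real.exp (-(b * E)) - Real.exp (-(b * (E + Δ))) := by
    rw [sub_nonneg, Real.exp_le_exp]
    linarith
  have hD : (n.descFactorial (l + 1) : ℝ) ≤ (n : ℝ) ^ (l + 1) := by
    exact_mod_cast Nat.descFactorial_le_pow n (l + 1)
  calc _ ≤ (n : ℝ) ^ (l + 1) * (Real.exp (-(b * E)) * (b * q * (1 + c * (x + u) ^ γ))) *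
        (Real.exp (-(b * E)) * (b * Δ)) ^ l * Real.exp (-(b * E)) ^ (n - 1 - l) := by
        have : (b * (1 - γ) * q + (b * (x + y + u) ^ (γ - 1)) ^ 2) *
            Real.exp (-(b * (E + Δ))) ≤ Real.exp (-(b * E)) * (b * q * (1 + c * (x + u) ^ γ)) := by
          rw [hsplit, mul_left_comm]
          exact mul_le_mul_of_nonneg_left claim1 (Real.exp_pos _).le
        gcongr
    _ = (n * b) ^ (l + 1) * q * (1 + c * (x + u) ^ γ) * Δ ^ l *
        Real.exp (-(b * E)) ^ (1 + l + (n - 1 - l)) := by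
        rw [pow_add, pow_add, pow_one]; ring
    _ = (1 - γ)⁻¹ * ((c * Δ) ^ l * (c * (1 - γ) * q) * Real.exp (-(c * E)) *
        (1 + c * (x + u) ^ γ)) := by
        have e1 : 1 + l + (n - 1 - l) = n := by omega
        have e2 : n * b = c := mul_div_cancel₀ c hn0.ne'
        have e3 : Real.exp (-(b * E)) ^ n = Real.exp (-(c * E)) := by
          rw [← Real.exp_nat_mul, ← e2]; ring_nf
        rw [e1, e2, e3, mul_pow, pow_succ]
        field_simp

theorem tendsto_descFactorial_div_pow (m : ℕ) :
    Tendsto (fun n : ℕ => (n.descFactorial m : ℝ) / (n : ℝ) ^ m) atTop (𝓝 1) := by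
  induction m with
  | zero => simp
  | succ m ih =>
    have h : Tendsto (fun n : ℕ => 1 - (m : ℝ) / n) atTop (𝓝 1) := by
      simpa using (tendsto_const_div_atTop_nhds_zero_nat (m : ℝ)).const_sub 1
    refine Tendsto.congr' ?_ (by simpa using h.mul ih)
    filter_upwards [eventually_ge_atTop (m + 1)] with n hn
    have hn0 : 0 < (n : ℝ) := by exact_mod_cast (by omega : 0 < n)
    rw [Nat.descFactorial_succ, pow_succ, Nat.cast_mul, Nat.cast_sub (by omega)]
    field_simp

theorem tendsto_factorialMomentIntegrand {γ u c : ℝ} (l : ℕ) (x y : ℝ) :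
    Tendsto (fun n => factorialMomentIntegrand γ u c l n x y) atTop
      (𝓝 (psiIntegrand γ u c l x y)) := by
  set E := genGammaExponent γ u x with hE
  set E' := genGammaExponent γ u (x + y) with hE'
  have hdiv : ∀ a : ℝ, Tendsto (fun n : ℕ => a / n) atTop (𝓝 0) :=
    tendsto_const_div_atTop_nhds_zero_nat
  have hexp : Tendsto (fun n : ℕ => Real.exp (-(c / n * E'))) atTop (𝓝 1) := by
    have := ((hdiv c).mul_const E').neg.rexp
    simpa using this
  have hL2 : Tendsto (fun n : ℕ => c * (1 - γ) * (x + y + u) ^ (γ - 2) +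
      (c * (x + y + u) ^ (γ - 1)) ^ 2 / n) atTop (𝓝 (c * (1 - γ) * (x + y + u) ^ (γ - 2))) := by
    simpa using (hdiv ((c * (x + y + u) ^ (γ - 1)) ^ 2)).const_add
      (c * (1 - γ) * (x + y + u) ^ (γ - 2))
  have hL1 : Tendsto (fun n : ℕ => (n : ℝ) *
      (Real.exp (-(c / n * E)) - Real.exp (-(c / n * E')))) atTop (𝓝 (c * (E' - E))) := by
    have hd : HasDerivAt (fun t : ℝ => Real.exp (-(c * t * E)) - Real.exp (-(c * t * E')))
        (c * (E' - E)) 0 := by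
      have h : ∀ E : ℝ, HasDerivAt (fun t : ℝ => Real.exp (-(c * t * E))) (-(c * E)) 0 := fun E => by
        have := (((hasDerivAt_id' (0 : ℝ)).const_mul c).mul_const E).fun_neg.exp
        exact this.congr_deriv (by simp)
      exact ((h E).sub (h E')).congr_deriv (by ring)
    have ht : Tendsto (fun n : ℕ => 1 / (n : ℝ)) atTop (𝓝[≠] 0) := by
      refine tendsto_nhdsWithin_iff.2 ⟨hdiv 1, ?_⟩
      filter_upwards [eventually_gt_atTop 0] with n hn
      have : (n : ℝ) ≠ 0 := by exact_mod_cast hn.ne'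
      simpa using this
    refine (hd.tendsto_slope_zero.comp ht).congr fun n => ?_
    simp only [Function.comp_apply, zero_add, mul_zero, zero_mul, neg_zero, Real.exp_zero, sub_self,
      sub_zero, smul_eq_mul, one_div, inv_inv, ← div_eq_mul_inv]
  have hL0 : Tendsto (fun n : ℕ => Real.exp (-(c / n * E)) ^ (n - 1 - l)) atTop
      (𝓝 (Real.exp (-(c * E)))) := by
    have h1 : Tendsto (fun n : ℕ => Real.exp (-((c - c * (1 + l) / n) * E))) atTop
        (𝓝 (Real.exp (-(c * E)))) := by
      have := (((hdiv (c * (1 + l))).const_sub c).mul_const E).neg.rexp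
      simpa using this
    refine h1.congr' ?_
    filter_upwards [eventually_ge_atTop (l + 1)] with n hn
    have hn0 : 0 < (n : ℝ) := by exact_mod_cast (by omega : 0 < n)
    rw [← Real.exp_nat_mul, Nat.sub_sub, Nat.cast_sub (by omega)]
    congr 1
    push_cast
    field_simp
  have key := (((tendsto_descFactorial_div_pow (l + 1)).mul (hL2.mul hexp)).mul (hL1.pow l)).mul hL0
  have e : psiIntegrand γ u c l x y = 1 * (c * (1 - γ) * (x + y + u) ^ (γ - 2) * 1) *
      (c * (E' - E)) ^ l * Real.exp (-(c * E)) := by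
    rw [psiIntegrand]; ring
  rw [e]
  refine key.congr' ?_
  filter_upwards [eventually_gt_atTop 0] with n hn
  have hn0 : 0 < (n : ℝ) := by exact_mod_cast hn
  rw [factorialMomentIntegrand, mul_pow (n : ℝ), pow_succ (n : ℝ), ← hE, ← hE']
  field_simp

/-- The `l`-th factorial moment of the search cost of `n` items whose weights have the Laplace
transform `e^{-cη/n}`. -/
noncomputable def factorialMoment (γ u c : ℝ) (l n : ℕ) : ℝ≥0∞ :=
  ∫⁻ x in Set.Ioi (0 : ℝ), ∫⁻ y in Set.Ioi (0 : ℝ),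
    ENNReal.ofReal (factorialMomentIntegrand γ u c l n x y)

theorem lintegral_Ioi_Ioi_eq {f : ℝ × ℝ → ℝ≥0∞} (hf : Measurable f) :
    ∫⁻ x in Set.Ioi (0 : ℝ), ∫⁻ y in Set.Ioi (0 : ℝ), f (x, y) =
      ∫⁻ q in Set.Ioi (0 : ℝ) ×ˢ Set.Ioi (0 : ℝ), f q := by
  rw [Measure.volume_eq_prod, ← Measure.prod_restrict, lintegral_prod _ hf.aemeasurable]

theorem factorialMoment_eq (γ u c : ℝ) (l n : ℕ) : factorialMoment γ u c l n =
    ∫⁻ q in Set.Ioi (0 : ℝ) ×ˢ Set.Ioi (0 : ℝ),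
      ENNReal.ofReal (factorialMomentIntegrand γ u c l n q.1 q.2) :=
  lintegral_Ioi_Ioi_eq
    (ENNReal.measurable_ofReal.comp (measurable_factorialMomentIntegrand γ u c l n))

theorem measurable_factorialMoment (γ u : ℝ) (l n : ℕ) :
    Measurable fun c => factorialMoment γ u c l n := by
  simp only [factorialMoment_eq]
  exact (measurable_factorialMomentIntegrand_prod γ u l n).ennreal_ofReal.lintegral_prod_right'

theorem lintegral_psiIntegrand_eq_prod (γ u c : ℝ) (l : ℕ) :
    ∫⁻ x in Set.Ioi (0 : ℝ), ∫⁻ y in Set.Ioi (0 : ℝ), ENNReal.ofReal (psiIntegrand γ u c l x y) =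
      ∫⁻ q in Set.Ioi (0 : ℝ) ×ˢ Set.Ioi (0 : ℝ), ENNReal.ofReal (psiIntegrand γ u c l q.1 q.2) :=
  lintegral_Ioi_Ioi_eq (ENNReal.measurable_ofReal.comp (measurable_psiIntegrand γ u c l))

theorem lintegral_psiIntegrand_le_liminf (γ u c : ℝ) (l : ℕ) :
    ∫⁻ x in Set.Ioi (0 : ℝ), ∫⁻ y in Set.Ioi (0 : ℝ), ENNReal.ofReal (psiIntegrand γ u c l x y) ≤
      liminf (fun n => factorialMoment γ u c l n) atTop := by
  simp only [factorialMoment_eq, lintegral_psiIntegrand_eq_prod]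
  refine le_trans (lintegral_mono fun q => ?_) (lintegral_liminf_le fun n =>
    ENNReal.measurable_ofReal.comp (measurable_factorialMomentIntegrand γ u c l n))
  exact ((ENNReal.continuous_ofReal.tendsto _).comp
    (tendsto_factorialMomentIntegrand l q.1 q.2)).liminf_eq.ge

theorem factorialMoment_le {γ u c : ℝ} (hγ : 0 < γ) (hγ1 : γ < 1) (hu : 0 ≤ u) (hc : 0 < c)
    {l : ℕ} (h : γ < 1 / ((l : ℝ) + 1)) (n : ℕ) :
    factorialMoment γ u c l n ≤ ENNReal.ofReal ((1 - γ)⁻¹ *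
      (l.factorial / (ascPochhammer ℝ l).eval (1 / γ - l - 1) *
        (truncatedExp l (c * u ^ γ / γ) + γ * truncatedExp (l + 1) (c * u ^ γ / γ)))) := by
  have h1γ : 0 < 1 - γ := by linarith
  rw [ENNReal.ofReal_mul (by positivity), ← lintegral_psiIntegrand_mul hγ hγ1 hu hc h,
    ← lintegral_const_mul' _ _ ENNReal.ofReal_ne_top]
  refine setLIntegral_mono' measurableSet_Ioi fun x hx => ?_
  rw [← lintegral_const_mul' _ _ ENNReal.ofReal_ne_top]
  refine setLIntegral_mono' measurableSet_Ioi fun y hy => ?_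
  rw [← ENNReal.ofReal_mul (by positivity)]
  exact ENNReal.ofReal_le_ofReal (factorialMomentIntegrand_le hγ hγ1 hu hc l n hx hy)

theorem tendsto_factorialMoment {γ u c : ℝ} (hγ : 0 < γ) (hγ1 : γ < 1) (hu : 0 ≤ u) (hc : 0 < c)
    {l : ℕ} (h : γ < 1 / ((l : ℝ) + 1)) :
    Tendsto (fun n => factorialMoment γ u c l n) atTop
      (𝓝 (∫⁻ x in Set.Ioi (0 : ℝ), ∫⁻ y in Set.Ioi (0 : ℝ),
        ENNReal.ofReal (psiIntegrand γ u c l x y))) := by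
  have h1γ : 0 < 1 - γ := by linarith
  have hmeas : Measurable fun q : ℝ × ℝ => ENNReal.ofReal ((1 - γ)⁻¹ *
      (psiIntegrand γ u c l q.1 q.2 * (1 + c * (q.1 + u) ^ γ))) := by
    have := measurable_psiIntegrand γ u c l
    fun_prop
  simp only [factorialMoment_eq, lintegral_psiIntegrand_eq_prod]
  refine tendsto_lintegral_of_dominated_convergence (fun q : ℝ × ℝ => ENNReal.ofReal ((1 - γ)⁻¹ *
      (psiIntegrand γ u c l q.1 q.2 * (1 + c * (q.1 + u) ^ γ)))) (fun n =>
    ENNReal.measurable_ofReal.comp (measurable_factorialMomentIntegrand γ u c l n)) ?_ ?_ ?_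
  · intro n
    filter_upwards [ae_restrict_mem (measurableSet_Ioi.prod measurableSet_Ioi)] with q hq
    exact ENNReal.ofReal_le_ofReal (factorialMomentIntegrand_le hγ hγ1 hu hc l n hq.1 hq.2)
  · rw [← lintegral_Ioi_Ioi_eq hmeas]
    simp only [ENNReal.ofReal_mul (inv_nonneg.2 h1γ.le) (q := _ * _)]
    simp only [lintegral_const_mul' _ _ ENNReal.ofReal_ne_top,
      lintegral_psiIntegrand_mul hγ hγ1 hu hc h]
    exact ENNReal.mul_ne_top ENNReal.ofReal_ne_top ENNReal.ofReal_ne_top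
  · exact ae_of_all _ fun q => (ENNReal.continuous_ofReal.tendsto _).comp
      (tendsto_factorialMomentIntegrand l q.1 q.2)

/-! ### Increments of subordinators, at a fixed and at a random clock speed -/

theorem meanSearchCostMoment_incrementWeights {Ω : Type*} [MeasurableSpace Ω] {P : Measure Ω}
    [IsProbabilityMeasure P] {I : Set ℝ} {ξ : ℝ → Ω → ℝ} (hξ : IsSubordinatorOn I ξ P)
    {γ u κ z : ℝ} (hγ : 0 < γ) (hu : 0 ≤ u) (hκ : 0 < κ) (hz : 0 < z)
    (hL : ∀ t ∈ I, ∀ s, 0 ≤ s →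
      ∫ ω, Real.exp (-(s * ξ t ω)) ∂P = Real.exp (-(t * (κ * genGammaExponent γ u s))))
    (hI : ∀ t ∈ Set.Icc (0 : ℝ) 1, z * t ∈ I) (n : ℕ) {k : ℕ} (hk : 1 ≤ k) :
    meanSearchCostMoment P (fun ω => incrementWeights ξ z n ω) k =
      ∑ l ∈ Finset.Icc 1 k, (Nat.stirlingSecond k l : ℝ≥0∞) * factorialMoment γ u (z * κ) l n := by
  have hmem : ∀ j : ℕ, j ≤ n → z * ((j : ℝ) / n) ∈ I := fun j hj => hI _
    ⟨by positivity, div_le_one_of_le₀ (by exact_mod_cast hj) (by positivity)⟩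
  have hmem0 : ∀ i : Fin n, z * ((i : ℝ) / n) ∈ I := fun i => hmem i i.2.le
  have hmem1 : ∀ i : Fin n, z * (((i : ℝ) + 1) / n) ∈ I := fun i => by
    have := hmem (i + 1) i.2
    push_cast at this
    exact this
  have hm : ∀ i, Measurable fun ω => incrementWeights ξ z n ω i := fun i =>
    (hξ.measurable _ (hmem1 i)).sub (hξ.measurable _ (hmem0 i))
  have hind : iIndepFun (fun i ω => incrementWeights ξ z n ω i) P := by
    have := hξ.indep n (fun j => ⟨z * (((j : ℕ) : ℝ) / n), hmem j (Nat.lt_succ_iff.1 j.2)⟩) (by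
      intro i j hij
      have : ((i : ℕ) : ℝ) ≤ ((j : ℕ) : ℝ) := by exact_mod_cast hij
      simp only [Subtype.mk_le_mk]
      gcongr)
    simpa [incrementWeights] using this
  have hle : ∀ i : Fin n, z * ((i : ℝ) / n) ≤ z * (((i : ℝ) + 1) / n) := fun i => by
    gcongr
    linarith
  have hnn : ∀ i, ∀ᵐ ω ∂P, 0 ≤ incrementWeights ξ z n ω i := fun i => by
    filter_upwards [hξ.paths] with ω hω
    exact sub_nonneg.2 (hω.1 (hmem0 i) (hmem1 i) (hle i))
  have hLw : ∀ i, ∀ s, 0 ≤ s → ∫ ω, Real.exp (-(s * incrementWeights ξ z n ω i)) ∂P =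
      Real.exp (-(z * κ / n * genGammaExponent γ u s)) := by
    intro i s hs
    have hn : 0 < (n : ℝ) := by exact_mod_cast i.pos
    have hsub : z * (((i : ℝ) + 1) / n) - z * ((i : ℝ) / n) = z * ((1 : ℕ) / n) := by
      field_simp
      push_cast
      ring
    have hst := hξ.stationary _ (hmem0 i) _ (hmem1 i) (hle i)
    have hid := hst.comp (u := fun v => Real.exp (-(s * v))) (by fun_prop)
    have := hid.integral_eq
    simp only [Function.comp_apply] at this
    simp only [incrementWeights]
    rw [this, hsub, hL _ (hmem 1 i.pos) s hs]
    congr 1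
    push_cast
    ring
  have hpos : ∀ᵐ ω ∂P, ∀ i, 0 < incrementWeights ξ z n ω i := by
    rw [ae_all_iff]
    intro i
    have hn : 0 < (n : ℝ) := by exact_mod_cast i.pos
    refine ae_pos_of_integral_exp_neg_tendsto (hm i) (hnn i) ?_
    have ht : Tendsto (fun s => Real.exp (-(z * κ / n * genGammaExponent γ u s))) atTop (𝓝 0) :=
      Real.tendsto_exp_neg_atTop_nhds_zero.comp
        ((tendsto_genGammaExponent hγ u).const_mul_atTop (by positivity))
    refine ht.congr' ?_
    filter_upwards [eventually_ge_atTop 0] with s hs using (hLw i s hs).symm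
  rw [meanSearchCostMoment_eq_of_iIndepFun P _ hm hind hpos
    (fun x => ENNReal.ofReal (Real.exp (-(z * κ / n * genGammaExponent γ u x))))
    (fun s => ENNReal.ofReal ((z * κ / n * (1 - γ) * (s + u) ^ (γ - 2) +
      (z * κ / n * (s + u) ^ (γ - 1)) ^ 2) * Real.exp (-(z * κ / n * genGammaExponent γ u s))))
    (fun x y => ENNReal.ofReal (Real.exp (-(z * κ / n * genGammaExponent γ u x)) -
      Real.exp (-(z * κ / n * genGammaExponent γ u (x + y)))))
    (fun i x hx => lintegral_exp_neg_mul (hm i) (hnn i) (hLw i) hx.le)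
    (fun i x y hx hy => lintegral_exp_neg_mul_sub (hm i) (hnn i) (hLw i) hx.le (by linarith))
    (fun i s hs => lintegral_sq_mul_exp_neg_mul hγ hu (hm i) (hnn i) (hLw i) hs) k hk]
  refine Finset.sum_congr rfl fun l _ => ?_
  congr 1
  unfold factorialMoment
  rw [← lintegral_const_mul' _ _ (ENNReal.natCast_ne_top _)]
  refine setLIntegral_congr_fun measurableSet_Ioi fun x hx => ?_

  rw [← lintegral_const_mul' _ _ (ENNReal.natCast_ne_top _)]
  refine setLIntegral_congr_fun measurableSet_Ioi fun y hy => ?_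
  have hx0 : (0 : ℝ) < x := hx
  have hy0 : (0 : ℝ) < y := hy
  have hd : 0 ≤ Real.exp (-(z * κ / n * genGammaExponent γ u x)) -
      Real.exp (-(z * κ / n * genGammaExponent γ u (x + y))) := by
    rw [sub_nonneg, Real.exp_le_exp, neg_le_neg_iff]
    exact mul_le_mul_of_nonneg_left (genGammaExponent_mono hγ hu hx0.le (by linarith))
      (by positivity)
  simp only [factorialMomentIntegrand]
  rw [ENNReal.ofReal_mul' (q := Real.exp (-(z * κ / n * genGammaExponent γ u x)) ^ (n - 1 - l))
      (by positivity), ENNReal.ofReal_mul' (q := (Real.exp _ - Real.exp _) ^ l) (pow_nonneg hd l),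
    ENNReal.ofReal_mul (p := (n.descFactorial (l + 1) : ℝ)) (Nat.cast_nonneg _),
    ENNReal.ofReal_natCast, ENNReal.ofReal_pow hd,
    ENNReal.ofReal_pow (by positivity)]
  ring

theorem Measurable.ofReal_searchCostMoment {α : Type*} [MeasurableSpace α] {n : ℕ}
    {V : α → Fin n → ℝ} (hV : Measurable V) (k : ℕ) :
    Measurable fun a => ENNReal.ofReal (searchCostMoment k (normalizedWeights (V a))) := by
  have h : Measurable fun w : Fin n → ℝ => searchCostMoment k (normalizedWeights w) := by
    unfold searchCostMoment mtfStationary normalizedWeights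
    fun_prop
  exact ENNReal.measurable_ofReal.comp (h.comp hV)

/-- The grid point `(j + 1) / (m + 1)`. For `j = ⌊(m + 1) t⌋` it lies strictly to the right of
`t ≥ 0`, at distance at most `1 / (m + 1)`. -/
noncomputable def rightGridPoint (m j : ℕ) : ℝ≥0 :=
  ((j : ℝ≥0) + 1) / (m + 1)

/-- The evaluation of right-continuous paths, as a jointly measurable function of the path and the
time: a limit along grid points that approach the time from the right. -/
noncomputable def rightLimitEval (p : ℝ≥0 → ℝ) (t : ℝ) : ℝ :=
  limsup (fun m : ℕ => p (rightGridPoint m ⌊(m + 1) * t⌋₊)) atTop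

theorem measurable_rightLimitEval_mul (a : ℝ) :
    Measurable fun q : (ℝ≥0 → ℝ) × ℝ => rightLimitEval q.1 (q.2 * a) := by
  refine Measurable.limsup fun m => ?_
  have h1 : Measurable fun q : (ℝ≥0 → ℝ) × ℕ => q.1 (rightGridPoint m q.2) :=
    measurable_from_prod_countable_left fun j => measurable_pi_apply (rightGridPoint m j)
  have h2 : Measurable fun q : (ℝ≥0 → ℝ) × ℝ => (q.1, ⌊((m : ℝ) + 1) * (q.2 * a)⌋₊) :=
    measurable_fst.prodMk (Nat.measurable_floor.comp ((measurable_snd.mul_const a).const_mul _))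
  exact h1.comp h2

theorem rightLimitEval_eq {f : ℝ → ℝ} {t : ℝ} (ht : 0 ≤ t)
    (hf : ContinuousWithinAt f (Set.Ici 0 ∩ Set.Ici t) t) :
    rightLimitEval (fun s => f s) t = f t := by
  refine Tendsto.limsup_eq ?_
  have hgt : ∀ m : ℕ, t ≤ (rightGridPoint m ⌊((m : ℝ) + 1) * t⌋₊ : ℝ) := fun m => by
    have := Nat.lt_floor_add_one (((m : ℝ) + 1) * t)
    simp only [rightGridPoint]
    push_cast
    rw [le_div_iff₀ (by positivity)]
    linarith
  have hlim : Tendsto (fun m : ℕ => (rightGridPoint m ⌊((m : ℝ) + 1) * t⌋₊ : ℝ)) atTop (𝓝 t) := by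
    have hup : Tendsto (fun m : ℕ => t + 1 / ((m : ℝ) + 1)) atTop (𝓝 t) := by
      simpa using (tendsto_one_div_add_atTop_nhds_zero_nat (𝕜 := ℝ)).const_add t
    refine tendsto_of_tendsto_of_tendsto_of_le_of_le tendsto_const_nhds hup hgt fun m => ?_
    have := Nat.floor_le (mul_nonneg (by positivity : (0 : ℝ) ≤ (m : ℝ) + 1) ht)
    simp only [rightGridPoint]
    push_cast
    have hm : (0 : ℝ) < m + 1 := by positivity
    rw [div_le_iff₀ hm, add_mul t, one_div_mul_cancel hm.ne']
    linarith
  refine hf.tendsto.comp (tendsto_nhdsWithin_iff.2 ⟨hlim, Eventually.of_forall fun m => ?_⟩)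
  exact ⟨NNReal.coe_nonneg _, hgt m⟩

/-- Conditioning on the independent clock speed `Z`. -/
theorem meanSearchCostMoment_randomClock {Ω : Type*} [MeasurableSpace Ω] {P : Measure Ω}
    [IsProbabilityMeasure P] {ξ : ℝ → Ω → ℝ} (hξ : IsSubordinatorOn (Set.Ici 0) ξ P) {Z : Ω → ℝ}
    {μ : Measure ℝ} (hZm : Measurable Z) (hZ : HasLaw Z μ P) (hμ : ∀ᵐ z ∂μ, 0 < z)
    (hind : IndepFun (fun ω (t : ℝ≥0) => ξ t ω) Z P) (n k : ℕ) :
    meanSearchCostMoment P (fun ω => incrementWeights ξ (Z ω) n ω) k =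
      ∫⁻ z, meanSearchCostMoment P (fun ω => incrementWeights ξ z n ω) k ∂μ := by
  let V : (ℝ≥0 → ℝ) × ℝ → Fin n → ℝ := fun q i =>
    rightLimitEval q.1 (q.2 * (((i : ℝ) + 1) / n)) - rightLimitEval q.1 (q.2 * ((i : ℝ) / n))
  let F : (ℝ≥0 → ℝ) × ℝ → ℝ≥0∞ := fun q =>
    ENNReal.ofReal (searchCostMoment k (normalizedWeights (V q)))
  have hF : Measurable F := by
    have hV : Measurable V :=
      measurable_pi_lambda V fun i => (measurable_rightLimitEval_mul (((i : ℝ) + 1) / n)).sub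
        (measurable_rightLimitEval_mul ((i : ℝ) / n))
    exact hV.ofReal_searchCostMoment k
  have hpath : Measurable fun ω (t : ℝ≥0) => ξ t ω :=
    measurable_pi_lambda _ fun t => hξ.measurable t t.2
  have hae : ∀ᵐ ω ∂P, ∀ z, 0 < z → F (fun t => ξ t ω, z) =
      ENNReal.ofReal (searchCostMoment k (normalizedWeights (incrementWeights ξ z n ω))) := by
    filter_upwards [hξ.paths] with ω hω z hz
    have h : ∀ a : ℝ, 0 ≤ a → rightLimitEval (fun t => ξ t ω) (z * a) = ξ (z * a) ω := fun a ha =>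
      rightLimitEval_eq (f := fun t => ξ t ω) (mul_nonneg hz.le ha) (hω.2 _ (mul_nonneg hz.le ha))
    simp only [F]
    congr 3
    ext i
    simp only [V]
    rw [h _ (by positivity), h _ (by positivity), incrementWeights]
  have hZpos : ∀ᵐ ω ∂P, 0 < Z ω := by
    have := hZ.map_eq ▸ hμ
    exact ae_of_ae_map hZm.aemeasurable this
  have hprob : SFinite μ := hZ.map_eq ▸ inferInstance
  have hmap := (indepFun_iff_map_prod_eq_prod_map_map hpath.aemeasurable hZm.aemeasurable).1 hind
  calc _ = ∫⁻ ω, F (fun t => ξ t ω, Z ω) ∂P := by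
        refine lintegral_congr_ae ?_
        filter_upwards [hae, hZpos] with ω h1 h2 using (h1 _ h2).symm
    _ = ∫⁻ q, F q ∂((P.map fun ω (t : ℝ≥0) => ξ t ω).prod μ) := by
        rw [← hZ.map_eq, ← hmap, lintegral_map hF (hpath.prodMk hZm)]
    _ = ∫⁻ z, ∫⁻ p, F (p, z) ∂(P.map fun ω (t : ℝ≥0) => ξ t ω) ∂μ :=
        lintegral_prod_symm _ hF.aemeasurable
    _ = _ := by
        refine lintegral_congr_ae ?_
        filter_upwards [hμ] with z hz
        have hFz : Measurable fun p => F (p, z) := hF.comp measurable_prodMk_right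
        rw [lintegral_map hFz hpath]
        refine lintegral_congr_ae ?_
        filter_upwards [hae] with ω h using h z hz

/-! ### Gamma mixtures -/

theorem lintegral_gammaMeasure {α : ℝ} (f : ℝ → ℝ≥0∞) (hf : Measurable f) :
    ∫⁻ z, f z ∂(gammaMeasure α 1) = ∫⁻ z in Set.Ioi (0 : ℝ),
      ENNReal.ofReal ((Real.Gamma α)⁻¹ * (z ^ (α - 1) * Real.exp (-(1 * z)))) * f z := by
  have hm : Measurable (gammaPDF α 1) := (measurable_gammaPDFReal α 1).ennreal_ofReal
  rw [gammaMeasure, lintegral_withDensity_eq_lintegral_mul _ hm hf,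
    ← setLIntegral_univ, ← Set.Iio_union_Ici (a := (0 : ℝ)),
    lintegral_union measurableSet_Ici (Set.Iio_disjoint_Ici le_rfl),
    setLIntegral_congr_fun (g := fun _ => 0) measurableSet_Iio fun z hz => by
      simp [gammaPDF_of_neg hz], lintegral_zero, zero_add, setLIntegral_congr Ioi_ae_eq_Ici.symm]
  refine setLIntegral_congr_fun measurableSet_Ioi fun z hz => ?_
  simp only [Pi.mul_apply]
  rw [gammaPDF_of_nonneg (le_of_lt hz), Real.one_rpow, one_div, mul_assoc]

theorem ae_gammaMeasure_pos (α : ℝ) : ∀ᵐ z ∂(gammaMeasure α 1), 0 < z := by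
  rw [ae_iff, ← lintegral_indicator_one (by measurability),
    lintegral_gammaMeasure _ (measurable_one.indicator (by measurability))]
  rw [setLIntegral_congr_fun (g := fun _ => 0) measurableSet_Ioi fun z hz => by
    simp [Set.indicator, (show 0 < z from hz)]]
  simp

theorem sum_ascPochhammer_div_factorial (α : ℝ) (l : ℕ) :
    l.factorial * ∑ m ∈ Finset.range (l + 1), (ascPochhammer ℝ m).eval α / m.factorial =
      (ascPochhammer ℝ l).eval (α + 1) := by
  induction l with
  | zero => simp
  | succ l ih =>
    have h1 : (ascPochhammer ℝ (l + 1)).eval α = α * (ascPochhammer ℝ l).eval (α + 1) := by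
      rw [ascPochhammer_succ_left]
      simp
    rw [Finset.sum_range_succ, mul_add, mul_div_cancel₀ _ (by positivity), h1, Nat.factorial_succ]
    push_cast
    rw [mul_assoc, ih, ascPochhammer_succ_eval]
    ring

theorem lintegral_truncatedExp_gammaMeasure {α : ℝ} (hα : 0 < α) (l : ℕ) :
    ∫⁻ z, ENNReal.ofReal (truncatedExp l z) ∂(gammaMeasure α 1) =
      ENNReal.ofReal ((ascPochhammer ℝ l).eval (α + 1)) := by
  have hm : Measurable (truncatedExp l) := by unfold truncatedExp; fun_prop
  have hΓ := Real.Gamma_pos_of_pos hα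
  rw [lintegral_gammaMeasure _ hm.ennreal_ofReal]
  have e : ∀ z ∈ Set.Ioi (0 : ℝ),
      ENNReal.ofReal ((Real.Gamma α)⁻¹ * (z ^ (α - 1) * Real.exp (-(1 * z)))) *
        ENNReal.ofReal (truncatedExp l z) =
      ∑ m ∈ Finset.range (l + 1), ENNReal.ofReal (l.factorial / m.factorial * (Real.Gamma α)⁻¹) *
        ENNReal.ofReal (z ^ ((α + m) - 1) * Real.exp (-(1 * z))) := by
    intro z hz
    have hz0 : (0 : ℝ) < z := hz
    have hnn : ∀ m : ℕ, 0 ≤ (l.factorial / m.factorial * (Real.Gamma α)⁻¹ : ℝ) := fun m => by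
      positivity
    simp only [← ENNReal.ofReal_mul (hnn _)]
    rw [← ENNReal.ofReal_mul (by positivity),
      ← ENNReal.ofReal_sum_of_nonneg fun m _ => by positivity, truncatedExp]
    congr 1
    rw [mul_left_comm, Finset.mul_sum, Finset.mul_sum]
    refine Finset.sum_congr rfl fun m _ => ?_
    rw [show α + m - 1 = (α - 1) + m by ring, Real.rpow_add hz0, Real.rpow_natCast]
    ring
  rw [setLIntegral_congr_fun measurableSet_Ioi e, lintegral_finsetSum' _ fun m _ => by fun_prop]
  have e2 : ∀ m ∈ Finset.range (l + 1), ∫⁻ z in Set.Ioi (0 : ℝ),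
      ENNReal.ofReal (l.factorial / m.factorial * (Real.Gamma α)⁻¹) *
        ENNReal.ofReal (z ^ ((α + m) - 1) * Real.exp (-(1 * z))) =
      ENNReal.ofReal (l.factorial * ((ascPochhammer ℝ m).eval α / m.factorial)) := by
    intro m _
    rw [lintegral_const_mul' _ _ ENNReal.ofReal_ne_top,
      lintegral_rpow_mul_exp_neg_mul (by positivity) one_pos, ← ENNReal.ofReal_mul (by positivity),
      Real.Gamma_add_natCast hα]
    congr 1
    simp
    field_simp
  rw [Finset.sum_congr rfl e2, ← ENNReal.ofReal_sum_of_nonneg fun m _ => by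
    have := ascPochhammer_pos m α hα
    positivity, ← Finset.mul_sum, sum_ascPochhammer_div_factorial]

theorem tendsto_lintegral_factorialMoment {γ θ : ℝ} (hγ : 0 < γ) (hγ1 : γ < 1) (hθ : 0 < θ) {l : ℕ}
    (h : γ < 1 / ((l : ℝ) + 1)) :
    Tendsto (fun n => ∫⁻ z, factorialMoment γ 1 (z * γ) l n ∂(gammaMeasure (θ / γ) 1)) atTop
      (𝓝 (∫⁻ z, (∫⁻ x in Set.Ioi (0 : ℝ), ∫⁻ y in Set.Ioi (0 : ℝ),
        ENNReal.ofReal (psiIntegrand γ 1 (z * γ) l x y)) ∂(gammaMeasure (θ / γ) 1))) := by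
  have h1γ : 0 < 1 - γ := by linarith
  have hK := ascPochhammer_pos l _ (one_div_sub_pos hγ h)
  have hα : 0 < θ / γ := by positivity
  have hcu : ∀ z : ℝ, z * γ * 1 ^ γ / γ = z := fun z => by
    rw [Real.one_rpow]; field_simp
  have hpos := ae_gammaMeasure_pos (θ / γ)
  refine tendsto_lintegral_of_dominated_convergence (fun z => ENNReal.ofReal ((1 - γ)⁻¹ *
      (l.factorial / (ascPochhammer ℝ l).eval (1 / γ - l - 1) *
        (truncatedExp l z + γ * truncatedExp (l + 1) z))))
    (fun n => (measurable_factorialMoment γ 1 l n).comp (measurable_id.mul_const γ)) ?_ ?_ ?_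
  · intro n
    filter_upwards [hpos] with z hz
    have := factorialMoment_le hγ hγ1 zero_le_one (mul_pos hz hγ) h n
    rwa [hcu] at this
  · have hm : ∀ j, Measurable (truncatedExp j) := fun j => by unfold truncatedExp; fun_prop
    have e : ∀ᵐ z ∂(gammaMeasure (θ / γ) 1), ENNReal.ofReal ((1 - γ)⁻¹ *
        (l.factorial / (ascPochhammer ℝ l).eval (1 / γ - l - 1) *
          (truncatedExp l z + γ * truncatedExp (l + 1) z))) =
        ENNReal.ofReal ((1 - γ)⁻¹ * (l.factorial / (ascPochhammer ℝ l).eval (1 / γ - l - 1))) *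
          (ENNReal.ofReal (truncatedExp l z) +
            ENNReal.ofReal γ * ENNReal.ofReal (truncatedExp (l + 1) z)) := by
      filter_upwards [hpos] with z hz
      have h1 := truncatedExp_nonneg l hz.le
      have h2 := truncatedExp_nonneg (l + 1) hz.le
      rw [← ENNReal.ofReal_mul hγ.le, ← ENNReal.ofReal_add h1 (by positivity),
        ← ENNReal.ofReal_mul (by positivity), mul_assoc]
    rw [lintegral_congr_ae e, lintegral_const_mul' _ _ ENNReal.ofReal_ne_top,
      lintegral_add_left (hm l).ennreal_ofReal, lintegral_const_mul' _ _ ENNReal.ofReal_ne_top,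
      lintegral_truncatedExp_gammaMeasure hα, lintegral_truncatedExp_gammaMeasure hα]
    finiteness
  · filter_upwards [hpos] with z hz
    exact tendsto_factorialMoment hγ hγ1 zero_le_one (mul_pos hz hγ) h

theorem liminf_factorialMoment_eq_top {γ u c : ℝ} (hγ : 0 < γ) (hγ1 : γ < 1) (hu : 0 ≤ u)
    (hc : 0 < c) {l : ℕ} (h : 1 / ((l : ℝ) + 1) ≤ γ) :
    liminf (fun n => factorialMoment γ u c l n) atTop = ⊤ := by
  have := lintegral_psiIntegrand_le_liminf γ u c l
  rwa [lintegral_psiIntegrand_eq_top hγ hγ1 hu hc h, top_le_iff] at this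

theorem tendsto_lintegral_factorialMoment_top {γ θ : ℝ} (hγ : 0 < γ) (hγ1 : γ < 1) (hθ : 0 < θ)
    {l : ℕ} (h : 1 / ((l : ℝ) + 1) ≤ γ) :
    Tendsto (fun n => ∫⁻ z, factorialMoment γ 1 (z * γ) l n ∂(gammaMeasure (θ / γ) 1)) atTop
      (𝓝 ⊤) := by
  have hprob := isProbabilityMeasure_gammaMeasure (div_pos hθ hγ) one_pos
  have e : ∫⁻ z, liminf (fun n => factorialMoment γ 1 (z * γ) l n) atTop
      ∂(gammaMeasure (θ / γ) 1) = ⊤ := by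
    rw [lintegral_congr_ae (g := fun _ => ⊤)]
    · simp
    · filter_upwards [ae_gammaMeasure_pos (θ / γ)] with z hz
      exact liminf_factorialMoment_eq_top hγ hγ1 zero_le_one (mul_pos hz hγ) h
  have hle := lintegral_liminf_le (μ := gammaMeasure (θ / γ) 1) (u := atTop) fun n =>
    (measurable_factorialMoment γ 1 l n).comp (measurable_id.mul_const γ)
  simp only [Function.comp_apply, id] at hle
  rw [e, top_le_iff] at hle
  exact tendsto_of_le_liminf_of_limsup_le hle.ge le_top

theorem tendsto_sum_top_of_le {ι : Type*} {s : Finset ι} {f : ι → ℕ → ℝ≥0∞} {i : ι} (hi : i ∈ s)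
    (h : Tendsto (f i) atTop (𝓝 ⊤)) : Tendsto (fun n => ∑ j ∈ s, f j n) atTop (𝓝 ⊤) :=
  tendsto_of_tendsto_of_tendsto_of_le_of_le h tendsto_const_nhds
    (fun n => Finset.single_le_sum (f := fun j => f j n) (fun _ _ => zero_le) hi) fun _ => le_top

/-! ### The limits of the moments -/

theorem lt_one_div_add_one_of_le {γ : ℝ} {k l : ℕ} (h : γ < 1 / ((k : ℝ) + 1)) (hl : l ≤ k) :
    γ < 1 / ((l : ℝ) + 1) := by
  refine h.trans_le (one_div_le_one_div_of_le (by positivity) ?_)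
  have : (l : ℝ) ≤ k := by exact_mod_cast hl
  linarith

theorem tendsto_factorialMoment_top {γ u c : ℝ} (hγ : 0 < γ) (hγ1 : γ < 1) (hu : 0 ≤ u)
    (hc : 0 < c) {l : ℕ} (h : 1 / ((l : ℝ) + 1) ≤ γ) :
    Tendsto (fun n => factorialMoment γ u c l n) atTop (𝓝 ⊤) :=
  tendsto_of_le_liminf_of_limsup_le (liminf_factorialMoment_eq_top hγ hγ1 hu hc h).ge le_top

theorem tendsto_stirlingSecond_sum {k : ℕ} {f : ℕ → ℕ → ℝ≥0∞} {g : ℕ → ℝ≥0∞}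
    (h : ∀ l ∈ Finset.Icc 1 k, Tendsto (f l) atTop (𝓝 (g l))) :
    Tendsto (fun n => ∑ l ∈ Finset.Icc 1 k, (Nat.stirlingSecond k l : ℝ≥0∞) * f l n) atTop
      (𝓝 (∑ l ∈ Finset.Icc 1 k, (Nat.stirlingSecond k l : ℝ≥0∞) * g l)) :=
  tendsto_finsetSum _ fun l hl =>
    ENNReal.Tendsto.const_mul (h l hl) (Or.inr (ENNReal.natCast_ne_top _))

theorem tendsto_stirlingSecond_sum_top {k : ℕ} (hk : 1 ≤ k) {f : ℕ → ℕ → ℝ≥0∞}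
    (h : Tendsto (f k) atTop (𝓝 ⊤)) :
    Tendsto (fun n => ∑ l ∈ Finset.Icc 1 k, (Nat.stirlingSecond k l : ℝ≥0∞) * f l n) atTop
      (𝓝 ⊤) := by
  refine tendsto_sum_top_of_le (i := k) (by simp [hk]) ?_
  simpa [Nat.stirlingSecond_self] using h

theorem laplaceExponent_smul_genGammaLevy {γ u κ s : ℝ} (hγ : 0 < γ) (hγ1 : γ < 1) (hu : 0 ≤ u)
    (hκ : 0 ≤ κ) (hs : 0 ≤ s) :
    laplaceExponent (ENNReal.ofReal κ • genGammaLevy γ u) s = κ * genGammaExponent γ u s := by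
  rw [← laplaceExponent_genGammaLevy hγ hγ1 hu hs, laplaceExponent, integral_smul_measure,
    ENNReal.toReal_ofReal hκ, smul_eq_mul, laplaceExponent]

theorem theorem4 (γ : ℝ) (hγ0 : 0 < γ) (hγ1 : γ < 1) :
    -- the generalized gamma subordinator with parameters `(γ, u)`
    (∀ u : ℝ, 0 ≤ u → ∀ k : ℕ, 1 ≤ k →
      (γ < 1 / ((k : ℝ) + 1) → ∀ l ∈ Finset.Icc 1 k,
        limitPsi (laplaceExponent (genGammaLevy γ u)) l =
          ENNReal.ofReal ((l.factorial : ℝ) ^ 2 / (ascPochhammer ℝ l).eval (1 / γ - l - 1) *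
            ∑ m ∈ Finset.range (l + 1), u ^ ((m : ℝ) * γ) / ((m.factorial : ℝ) * γ ^ m))) ∧
      (1 / ((k : ℝ) + 1) ≤ γ → limitPsi (laplaceExponent (genGammaLevy γ u)) k = ⊤) ∧
      (∀ (Ω : Type*) [MeasurableSpace Ω] (P : Measure Ω) [IsProbabilityMeasure P]
        (ξ : ℝ → Ω → ℝ), IsSubordinatorOn (Set.Icc 0 1) ξ P →
        HasLevyMeasureOn (Set.Icc 0 1) ξ (genGammaLevy γ u) P →
        (γ < 1 / ((k : ℝ) + 1) →
          Tendsto (fun n : ℕ => meanSearchCostMoment P (fun ω => incrementWeights ξ 1 n ω) k) atTop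
            (𝓝 (∑ l ∈ Finset.Icc 1 k, (Nat.stirlingSecond k l : ℝ≥0∞) *
              limitPsi (laplaceExponent (genGammaLevy γ u)) l))) ∧
        (1 / ((k : ℝ) + 1) ≤ γ →
          Tendsto (fun n : ℕ => meanSearchCostMoment P (fun ω => incrementWeights ξ 1 n ω) k) atTop
            (𝓝 ⊤)))) ∧
    -- the two-parameter Poisson–Dirichlet weights with parameters `(γ, θ)`; given `Z = z`, the
    -- weights are the increments of a subordinator with Laplace exponent `z ((1 + s) ^ γ - 1)`
    (∀ θ : ℝ, 0 < θ → ∀ k : ℕ, 1 ≤ k →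
      (γ < 1 / ((k : ℝ) + 1) → ∀ l ∈ Finset.Icc 1 k,
        ∫⁻ z, limitPsi (fun s => z * laplaceExponent (ENNReal.ofReal γ • genGammaLevy γ 1) s) l
            ∂(gammaMeasure (θ / γ) 1) =
          ENNReal.ofReal ((l.factorial : ℝ) * (ascPochhammer ℝ l).eval (θ / γ + 1) /
            (ascPochhammer ℝ l).eval (1 / γ - l - 1))) ∧
      (1 / ((k : ℝ) + 1) ≤ γ →
        ∫⁻ z, limitPsi (fun s => z * laplaceExponent (ENNReal.ofReal γ • genGammaLevy γ 1) s) k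
            ∂(gammaMeasure (θ / γ) 1) = ⊤) ∧
      (∀ (Ω : Type*) [MeasurableSpace Ω] (P : Measure Ω) [IsProbabilityMeasure P]
        (ξ : ℝ → Ω → ℝ) (Z : Ω → ℝ), IsSubordinatorOn (Set.Ici 0) ξ P →
        HasLevyMeasureOn (Set.Ici 0) ξ (ENNReal.ofReal γ • genGammaLevy γ 1) P →
        Measurable Z → HasLaw Z (gammaMeasure (θ / γ) 1) P →
        IndepFun (fun ω (t : ℝ≥0) => ξ t ω) Z P →
        (γ < 1 / ((k : ℝ) + 1) →
          Tendsto (fun n : ℕ => meanSearchCostMoment P (fun ω => incrementWeights ξ (Z ω) n ω) k)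
            atTop
            (𝓝 (∑ l ∈ Finset.Icc 1 k, (Nat.stirlingSecond k l : ℝ≥0∞) *
              ∫⁻ z, limitPsi
                  (fun s => z * laplaceExponent (ENNReal.ofReal γ • genGammaLevy γ 1) s) l
                ∂(gammaMeasure (θ / γ) 1)))) ∧
        (1 / ((k : ℝ) + 1) ≤ γ →
          Tendsto (fun n : ℕ => meanSearchCostMoment P (fun ω => incrementWeights ξ (Z ω) n ω) k)
            atTop (𝓝 ⊤)))) := by
  refine ⟨fun u hu k hk => ?_, fun θ hθ k hk => ?_⟩
  · have hpsi : ∀ l, limitPsi (laplaceExponent (genGammaLevy γ u)) l =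
        ∫⁻ x in Set.Ioi (0 : ℝ), ∫⁻ y in Set.Ioi (0 : ℝ),
          ENNReal.ofReal (psiIntegrand γ u 1 l x y) :=
      limitPsi_eq_lintegral hγ0 hu fun s hs => by
        rw [one_mul, laplaceExponent_genGammaLevy hγ0 hγ1 hu hs]
    refine ⟨fun h l hl => ?_, fun h => ?_, fun Ω _ P _ ξ hξ hL => ?_⟩
    · have h' := lt_one_div_add_one_of_le h (Finset.mem_Icc.1 hl).2
      rw [hpsi, lintegral_psiIntegrand hγ0 hγ1 hu one_pos h', truncatedExp]
      congr 1
      have e : ∀ m : ℕ, (1 * u ^ γ / γ) ^ m / (m.factorial : ℝ) =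
          u ^ ((m : ℝ) * γ) / ((m.factorial : ℝ) * γ ^ m) := fun m => by
        rw [one_mul, div_pow, ← Real.rpow_natCast (u ^ γ), ← Real.rpow_mul hu, mul_comm γ, div_div,
          mul_comm (γ ^ m)]
      simp only [e]
      ring
    · rw [hpsi, lintegral_psiIntegrand_eq_top hγ0 hγ1 hu one_pos h]
    · have hmean : ∀ n : ℕ, meanSearchCostMoment P (fun ω => incrementWeights ξ 1 n ω) k =
          ∑ l ∈ Finset.Icc 1 k, (Nat.stirlingSecond k l : ℝ≥0∞) *
            factorialMoment γ u 1 l n := fun n => by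
        rw [meanSearchCostMoment_incrementWeights hξ hγ0 hu one_pos one_pos
          (fun t ht s hs => by
            rw [hL.laplace t ht s hs, one_mul, laplaceExponent_genGammaLevy hγ0 hγ1 hu hs])
          (fun t ht => by rwa [one_mul]) n hk, one_mul]
      simp only [hmean, hpsi]
      refine ⟨fun h => tendsto_stirlingSecond_sum fun l hl => ?_, fun h =>
        tendsto_stirlingSecond_sum_top hk (tendsto_factorialMoment_top hγ0 hγ1 hu one_pos h)⟩
      exact tendsto_factorialMoment hγ0 hγ1 hu one_pos
        (lt_one_div_add_one_of_le h (Finset.mem_Icc.1 hl).2)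
  · have hα : 0 < θ / γ := div_pos hθ hγ0
    have hpsi : ∀ l, ∫⁻ z, limitPsi
          (fun s => z * laplaceExponent (ENNReal.ofReal γ • genGammaLevy γ 1) s) l
          ∂(gammaMeasure (θ / γ) 1) =
        ∫⁻ z, (∫⁻ x in Set.Ioi (0 : ℝ), ∫⁻ y in Set.Ioi (0 : ℝ),
          ENNReal.ofReal (psiIntegrand γ 1 (z * γ) l x y)) ∂(gammaMeasure (θ / γ) 1) := fun l =>
      lintegral_congr fun z => limitPsi_eq_lintegral hγ0 zero_le_one (fun s hs => by
        rw [laplaceExponent_smul_genGammaLevy hγ0 hγ1 zero_le_one hγ0.le hs, mul_assoc]) l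
    refine ⟨fun h l hl => ?_, fun h => ?_, fun Ω _ P _ ξ Z hξ hL hZm hZ hind => ?_⟩
    · have h' := lt_one_div_add_one_of_le h (Finset.mem_Icc.1 hl).2
      have hK := ascPochhammer_pos l _ (one_div_sub_pos hγ0 h')
      have e : ∀ᵐ z ∂(gammaMeasure (θ / γ) 1), ∫⁻ x in Set.Ioi (0 : ℝ), ∫⁻ y in Set.Ioi (0 : ℝ),
          ENNReal.ofReal (psiIntegrand γ 1 (z * γ) l x y) =
          ENNReal.ofReal (l.factorial / (ascPochhammer ℝ l).eval (1 / γ - l - 1)) *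
            ENNReal.ofReal (truncatedExp l z) := by
        filter_upwards [ae_gammaMeasure_pos (θ / γ)] with z hz
        rw [lintegral_psiIntegrand hγ0 hγ1 zero_le_one (mul_pos hz hγ0) h', Real.one_rpow, mul_one,
          mul_div_cancel_right₀ _ hγ0.ne', ENNReal.ofReal_mul (by positivity)]
      rw [hpsi, lintegral_congr_ae e, lintegral_const_mul' _ _ ENNReal.ofReal_ne_top,
        lintegral_truncatedExp_gammaMeasure hα, ← ENNReal.ofReal_mul (by positivity)]
      congr 1
      ring
    · have hprob := isProbabilityMeasure_gammaMeasure hα one_pos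
      rw [hpsi, lintegral_congr_ae (g := fun _ => ⊤)]
      · simp
      · filter_upwards [ae_gammaMeasure_pos (θ / γ)] with z hz
        exact lintegral_psiIntegrand_eq_top hγ0 hγ1 zero_le_one (mul_pos hz hγ0) h
    · have hmean : ∀ n : ℕ, meanSearchCostMoment P (fun ω => incrementWeights ξ (Z ω) n ω) k =
          ∑ l ∈ Finset.Icc 1 k, (Nat.stirlingSecond k l : ℝ≥0∞) *
            ∫⁻ z, factorialMoment γ 1 (z * γ) l n ∂(gammaMeasure (θ / γ) 1) := fun n => by
        have hm : ∀ l, Measurable fun z => factorialMoment γ 1 (z * γ) l n := fun l =>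
          (measurable_factorialMoment γ 1 l n).comp (measurable_id.mul_const γ)
        rw [meanSearchCostMoment_randomClock hξ hZm hZ (ae_gammaMeasure_pos _) hind]
        have e : ∀ᵐ z ∂(gammaMeasure (θ / γ) 1),
            meanSearchCostMoment P (fun ω => incrementWeights ξ z n ω) k =
            ∑ l ∈ Finset.Icc 1 k, (Nat.stirlingSecond k l : ℝ≥0∞) *
              factorialMoment γ 1 (z * γ) l n := by
          filter_upwards [ae_gammaMeasure_pos (θ / γ)] with z hz
          exact meanSearchCostMoment_incrementWeights hξ hγ0 zero_le_one hγ0 hz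
            (fun t ht s hs => by
              rw [hL.laplace t ht s hs,
                laplaceExponent_smul_genGammaLevy hγ0 hγ1 zero_le_one hγ0.le hs])
            (fun t ht => mul_nonneg hz.le ht.1) n hk
        rw [lintegral_congr_ae e, lintegral_finsetSum _ fun l _ => (hm l).const_mul _]
        exact Finset.sum_congr rfl fun l _ => lintegral_const_mul _ (hm l)
      simp only [hmean, hpsi]
      refine ⟨fun h => tendsto_stirlingSecond_sum (f := fun l n => _) fun l hl => ?_, fun h =>
        tendsto_stirlingSecond_sum_top (f := fun l n => _) hk
          (tendsto_lintegral_factorialMoment_top hγ0 hγ1 hθ h)⟩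
      exact tendsto_lintegral_factorialMoment hγ0 hγ1 hθ
        (lt_one_div_add_one_of_le h (Finset.mem_Icc.1 hl).2)
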